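/- Let $d\ge 1$ and let $a:\mathbb{R}^d\to[0,\infty)$ be measurable with $a^{(0)}:=\int_{\mathbb{R}^d} a(x)\,dx>0$ and $a(y)\le C(1+|y|)^{-\alpha}$ for all $y\in\mathbb{R}^d$, for some $\alpha>2d$ and some constant $C$. Let $\Gamma$ be the space of locally finite subsets $\gamma$ of $\mathbb{R}^d$, with the vague topology (the coarsest topology for which $\gamma\mapsto\langle f,\gamma\rangle:=\sum_{x\in\gamma}f(x)$ is continuous for all $f\in C_c(\mathbb{R}^d)$) and its Borel $\sigma$-algebra. For a bounded measurable $z\ge 0$, let $\pi_z$ be the Poisson measure on $\Gamma$ with intensity $z$, i.e. the probability measure with $\int_\Gamma e^{\langle\varphi,\gamma\rangle}\,\pi_z(d\gamma)=\exp\big(\int_{\mathbb{R}^d}(e^{\varphi(x)}-1)z(x)\,dx\big)$ for all $\varphi\in C_c^\infty(\mathbb{R}^d)$. In the free Kawasaki dynamics the particles of the initial configuration move independently of each other, each according to the continuous-time jump process that waits an exponential time of parameter $a^{(0)}$ and then jumps from its position $x$ to a point $y$ chosen with probability density $a(x-y)/a^{(0)}$. Let $P_{\mu,t}$ denote the law at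 time $t\ge0$ of the configuration when the initial configuration has law $\mu$, i.e. $P_{\mu,t}=\int_\Gamma \mathbf{P}_t(\gamma,\cdot)\,\mu(d\gamma)$, where $\mathbf{P}_t(\gamma,\cdot)$ is the law at time $t$ of the dynamics started in $\gamma$. Let $z_1,z_2\ge 0$ be bounded measurable functions on $\mathbb{R}^d$ with $z_1-z_2\in L^1(\mathbb{R}^d,dx)$. Then $P_{\pi_{z_1},t}$ and $P_{\pi_{z_2},t}$ are well-defined probability measures on $\Gamma$ for all $t\ge 0$, and the dynamics started from $\pi_{z_1}$ and from $\pi_{z_2}$ have the same large-time limit: for every probability measure $\nu$ on $\Gamma$, $P_{\pi_{z_1},t}$ converges weakly to $\nu$ as $t\to\infty$ if and only if $P_{\pi_{z_2},t}$ converges weakly to $\nu$ as $t\to\infty$. More generally, for every sequence of times $t_n\to\infty$ and every $\nu$, $P_{\pi_{z_1},t_n}\to\nu$ weakly if and only if $P_{\pi_{z_2},t_n}\to\nu$ weakly. -/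

import Mathlib

open MeasureTheory ProbabilityTheory Filter Topology
open scoped NNReal ENNReal BoundedContinuousFunction ContDiff CompactlySupported

namespace FreeKawasaki

/-- The Euclidean space `ℝ^d`. -/
abbrev Space (d : ℕ) : Type := EuclideanSpace ℝ (Fin d)

/-! ### The configuration space -/

/-- A set of points of `ℝ^d` is locally finite if it meets every compact set in a finite set. -/
def IsLocallyFinite {d : ℕ} (s : Set (Space d)) : Prop :=
  ∀ K : Set (Space d), IsCompact K → (s ∩ K).Finite

/-- The configuration space `Γ` over `ℝ^d`: all locally finite subsets of `ℝ^d`. -/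
def Config (d : ℕ) : Type := {s : Set (Space d) // IsLocallyFinite s}

namespace Config

variable {d : ℕ}

/-- The set of points of a configuration. -/
def points (γ : Config d) : Set (Space d) := γ.1

/-- The configuration without points. -/
def empty (d : ℕ) : Config d := ⟨∅, fun K _ => by simp⟩

/-- The pairing `⟨f, γ⟩ = ∑_{x ∈ γ} f x`. It is used for functions with compact support, for
which only finitely many summands are nonzero. -/
noncomputable def pairing (f : Space d → ℝ) (γ : Config d) : ℝ := ∑' x : γ.points, f x

/-- The vague topology: the coarsest topology for which `γ ↦ ⟨f, γ⟩` is continuous for every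
continuous `f` with compact support. -/
noncomputable instance : TopologicalSpace (Config d) :=
  ⨅ f : C_c(Space d, ℝ), TopologicalSpace.induced (fun γ => pairing f γ) inferInstance

/-- The Borel `σ`-algebra of the vague topology. -/
noncomputable instance : MeasurableSpace (Config d) := borel (Config d)

instance : BorelSpace (Config d) := ⟨rfl⟩

open Classical in
/-- A locally finite set as a configuration (sets that are not locally finite are sent to the
empty configuration). -/
noncomputable def ofSet (s : Set (Space d)) : Config d :=
  if h : IsLocallyFinite s then ⟨s, h⟩ else empty d

end Config

/-! ### Poisson measures -/

/-- `π` is the Poisson measure with intensity `z`: a probability measure on `Γ` whose Laplace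
transform is `∫ exp ⟨φ, γ⟩ π(dγ) = exp (∫ (exp (φ x) - 1) z x dx)` for all smooth `φ` with compact
support. (The right-hand side is not `0`, so the left-hand integrand is integrable.) -/
def IsPoisson {d : ℕ} (z : Space d → ℝ) (π : Measure (Config d)) : Prop :=
  IsProbabilityMeasure π ∧
    ∀ φ : Space d → ℝ, ContDiff ℝ ∞ φ → HasCompactSupport φ →
      ∫ γ, Real.exp (Config.pairing φ γ) ∂π
        = Real.exp (∫ x, (Real.exp (φ x) - 1) * z x)

open Classical in
/-- The Poisson measure `π_z` on the configuration space with intensity `z`, i.e. the probability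
measure with the above Laplace transform (`0` if there were none). -/
noncomputable def poissonField {d : ℕ} (z : Space d → ℝ) : Measure (Config d) :=
  if h : ∃ π : Measure (Config d), IsPoisson z π then h.choose else 0

/-! ### The one-particle jump process -/

/-- The total jump rate `a⁽⁰⁾ = ∫ a(x) dx`. -/
noncomputable def totalRate {d : ℕ} (a : Space d → ℝ) : ℝ := ∫ x, a x

/-- The probability measure with density `a / a⁽⁰⁾`. -/
noncomputable def jumpLaw {d : ℕ} (a : Space d → ℝ) : Measure (Space d) :=
  volume.withDensity fun u => ENNReal.ofReal (a u / totalRate a)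

/-- The randomness that drives one particle: a sequence of pairs (waiting time, jump). -/
abbrev Noise (d : ℕ) : Type := ℕ → ℝ × Space d

/-- Independent waiting times with exponential law of parameter `a⁽⁰⁾`, and, independently of them,
independent jumps with density `a / a⁽⁰⁾`. -/
noncomputable def noiseLaw {d : ℕ} (a : Space d → ℝ) : Measure (Noise d) :=
  Measure.infinitePi fun _ : ℕ => (expMeasure (totalRate a)).prod (jumpLaw a)

/-- The number `Z_t` of jumps up to time `t`: the number of `n` such that the `n`-th arrival time
(the sum of the waiting times number `0, …, n`) is at most `t`. Under `noiseLaw a` this is a Poisson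
process with parameter `a⁽⁰⁾`. -/
noncomputable def jumpCount {d : ℕ} (w : Noise d) (t : ℝ≥0) : ℕ :=
  Set.ncard {n : ℕ | ∑ k ∈ Finset.range (n + 1), (w k).1 ≤ (t : ℝ)}

/-- The Markov chain `Y_n` started at `x`. As `Y_{n+1} = Y_n - ξ_n` where `ξ_n` has
density `a / a⁽⁰⁾`, the transition density from `x` to `y` is `a (x - y) / a⁽⁰⁾`. -/
def chain {d : ℕ} (w : Noise d) (x : Space d) (n : ℕ) : Space d :=
  x - ∑ k ∈ Finset.range n, (w k).2

/-- The one-particle jump process `X_t = Y_{Z_t}` started at `x`; its generator is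
`A f (x) = ∫ a (x - y) (f y - f x) dy`. -/
noncomputable def particle {d : ℕ} (w : Noise d) (x : Space d) (t : ℝ≥0) : Space d :=
  chain w x (jumpCount w t)

/-! ### The free Kawasaki dynamics -/

/-- The law of the noise of the infinite particle system started in `γ`: the particles have
independent identically distributed noises. -/
noncomputable def systemLaw {d : ℕ} (a : Space d → ℝ) (γ : Config d) :
    Measure (γ.points → Noise d) :=
  Measure.infinitePi fun _ : γ.points => noiseLaw a

/-- The free Kawasaki process `(𝐗_t)` started in `γ`: the configuration at time `t` of the particles
that start in the points of `γ` and move independently according to the jump process. -/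
noncomputable def process {d : ℕ} (γ : Config d) (w : γ.points → Noise d) (t : ℝ≥0) : Config d :=
  Config.ofSet (Set.range fun x : γ.points => particle (w x) x t)

/-- The transition probability `𝐏_t(γ, ·)` of the free Kawasaki dynamics: the law of `𝐗_t` for the
process started in `γ`. -/
noncomputable def transition {d : ℕ} (a : Space d → ℝ) (t : ℝ≥0) (γ : Config d) :
    Measure (Config d) :=
  (systemLaw a γ).map fun w => process γ w t

/-- The one-dimensional distribution at time `t` of the free Kawasaki dynamics with initial
distribution `μ`, i.e. the measure `∫ 𝐏_t(γ, ·) μ(dγ)`. -/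
noncomputable def oneDimDistribution {d : ℕ} (a : Space d → ℝ) (μ : Measure (Config d))
    (t : ℝ≥0) : Measure (Config d) :=
  μ.bind (transition a t)

/-! ### Weak convergence -/

/-- Weak convergence of measures on the configuration space: convergence of the integrals of all
bounded continuous functions. -/
def ConvergesWeakly {d : ℕ} {ι : Type} (P : ι → Measure (Config d)) (l : Filter ι)
    (ν : Measure (Config d)) : Prop :=
  ∀ F : Config d →ᵇ ℝ, Tendsto (fun i => ∫ γ, F γ ∂(P i)) l (𝓝 (∫ γ, F γ ∂ν))

end FreeKawasaki

namespace FreeKawasaki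

/-! ### The vague topology seen through countably many smooth test functions. -/

namespace Config

variable {d : ℕ}

/-! The proof is a coupling. Write `z₁ = min z₁ z₂ + (z₁ - z₂)⁺` and `z₂ = min z₁ z₂ + (z₂ - z₁)⁺`.
As `z₁ - z₂` is integrable, each excess contributes an almost surely finite Poisson number of
points. Both Poisson fields are built on one probability space from independent clusters: the two
excesses and the common part cut into shells (`pieces`, `isPoisson_map_clusterLaw`). Giving every
potential particle its own noise realises both time-`t` laws together
(`oneDimDistribution_map_clusterLaw`), and the two configurations differ only through the particles
of the excess clusters.

Each particle leaves every ball in probability: the number of jumps diverges, and a nondegenerate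
random walk spreads out uniformly in its starting point (`exists_bound_particle_mem_closedBall`). So
with probability tending to 1 the two systems agree in any given ball (`map_evolved_le`,
`tendsto_jointLaw_visits`). This suffices for weak limits, because vaguely open sets are increasing
unions of open sets that look only at a ball, so the portmanteau theorem applies
(`ConvergesWeakly.of_local`).

Two foundational points remain. Integrating the transition probabilities requires their
measurability in the initial configuration (`measurable_transition`), and the explicit cluster field
must be identified with `poissonField`, which follows from uniqueness (`IsPoisson.unique`). -/

lemma finite_support_pairing {f : Space d → ℝ} (hf : HasCompactSupport f) (γ : Config d) :
    (Function.support fun x : γ.points => f x).Finite := by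
  have h : (Subtype.val '' (Function.support fun x : γ.points => f x)).Finite := by
    refine (γ.2 _ hf).subset ?_
    rintro _ ⟨x, hx, rfl⟩
    exact ⟨x.2, subset_tsupport f hx⟩
  exact h.of_finite_image Subtype.val_injective.injOn

lemma hasSum_pairing {f : Space d → ℝ} (hf : HasCompactSupport f) (γ : Config d) :
    HasSum (fun x : γ.points => f x) (pairing f γ) :=
  (summable_of_hasFiniteSupport (finite_support_pairing hf γ)).hasSum

/-- A uniform bound on `f - g` alone gives no control, since the number of points is unbounded over
configurations. The weight `χ` keeps track of that number. -/
lemma abs_pairing_sub_le {f g χ : Space d → ℝ} (hf : HasCompactSupport f)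
    (hg : HasCompactSupport g) (hχ : HasCompactSupport χ) {ε : ℝ}
    (h : ∀ x, |f x - g x| ≤ ε * χ x) (γ : Config d) :
    |pairing f γ - pairing g γ| ≤ ε * pairing χ γ := by
  have h1 := (hasSum_pairing hf γ).sub (hasSum_pairing hg γ)
  have h2 := (hasSum_pairing hχ γ).mul_left ε
  rw [abs_le]
  constructor
  · exact hasSum_le (fun x : γ.points => (abs_le.1 (h x)).1) h2.neg h1
  · exact hasSum_le (fun x : γ.points => (abs_le.1 (h x)).2) h1 h2

lemma continuous_pairing (f : C_c(Space d, ℝ)) : Continuous fun γ : Config d => pairing f γ :=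
  continuous_iInf_dom (i := f) continuous_induced_dom

lemma continuous_pairing_of_hasCompactSupport {f : Space d → ℝ} (hf : Continuous f)
    (hc : HasCompactSupport f) : Continuous fun γ : Config d => pairing f γ :=
  continuous_pairing ⟨⟨f, hf⟩, hc⟩

/-- A family of test functions that approximates every test function, relatively to one of its
members, induces the vague topology. -/
lemma topology_eq_induced {ι : Type*} {ψ : ι → Space d → ℝ} (hψ : ∀ i, Continuous (ψ i))
    (hψ' : ∀ i, HasCompactSupport (ψ i))
    (happ : ∀ f : C_c(Space d, ℝ), ∃ j, ∀ ε > 0, ∃ i, ∀ x, |f x - ψ i x| ≤ ε * ψ j x) :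
    (inferInstance : TopologicalSpace (Config d)) =
      TopologicalSpace.induced (fun γ i => pairing (ψ i) γ) Pi.topologicalSpace := by
  apply le_antisymm
  · rw [← continuous_iff_le_induced]
    exact continuous_pi fun i => continuous_pairing_of_hasCompactSupport (hψ i) (hψ' i)
  · refine le_iInf fun f => ?_
    rw [← continuous_iff_le_induced]
    let τ : TopologicalSpace (Config d) :=
      TopologicalSpace.induced (fun γ i => pairing (ψ i) γ) Pi.topologicalSpace
    have hc : ∀ i, Continuous fun γ : Config d => pairing (ψ i) γ := fun i =>
      (continuous_apply i).comp
        (continuous_induced_dom (f := fun (γ : Config d) i => pairing (ψ i) γ))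
    rw [continuous_iff_continuousAt]
    intro γ₀
    rw [ContinuousAt, Metric.tendsto_nhds]
    intro ε hε
    obtain ⟨j, hj⟩ := happ f
    -- `M` bounds the weight at `γ₀` and in a neighbourhood. The approximation then costs `ε / 4` at
    -- `γ` and again at `γ₀`, and the variation of `ψ i` costs a third `ε / 4`.
    set M := |pairing (ψ j) γ₀| + 1 with hM
    have hMpos : 0 < M := by positivity
    obtain ⟨i, hi⟩ := hj (ε / (4 * M)) (by positivity)
    have e1 : ∀ᶠ γ in 𝓝 γ₀, pairing (ψ j) γ < M :=
      (hc j).continuousAt.eventually_lt continuousAt_const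
        (lt_of_le_of_lt (le_abs_self _) (lt_add_one _))
    have e2 := Metric.tendsto_nhds.1 ((hc i).continuousAt (x := γ₀)) (ε / 4) (by positivity)
    have key : ∀ γ : Config d, pairing (ψ j) γ < M →
        |pairing f γ - pairing (ψ i) γ| ≤ ε / 4 := by
      intro γ hγ
      refine (abs_pairing_sub_le f.hasCompactSupport (hψ' i) (hψ' j) hi γ).trans ?_
      calc ε / (4 * M) * pairing (ψ j) γ ≤ ε / (4 * M) * M := by gcongr
        _ = ε / 4 := by field_simp
    filter_upwards [e1, e2] with γ h1 h2
    have h3 := abs_le.1 (key γ h1)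
    have h4 := abs_le.1 (key γ₀ e1.self_of_nhds)
    rw [Real.dist_eq, abs_lt] at h2 ⊢
    constructor <;> linarith [h3.1, h3.2, h4.1, h4.2, h2.1, h2.2]

/-- A smooth function with compact support that is `1` on the ball of radius `n + 1`. -/
noncomputable def cutoff (d n : ℕ) : ContDiffBump (0 : Space d) :=
  ⟨n + 1, n + 2, by positivity, by linarith⟩

/-- Smooth functions are dense for uniform convergence on compact sets; a countable dense family of
them is multiplied by cutoffs. The cutoffs themselves (`none`) serve as weights: if `f` lives where
the cutoff is 1, the error is the cutoff times `f - g`. -/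
lemma exists_smooth_family (d : ℕ) : ∃ ψ : ℕ → Space d → ℝ,
    (∀ n, ContDiff ℝ ∞ (ψ n)) ∧ (∀ n, HasCompactSupport (ψ n)) ∧
    ∀ f : C_c(Space d, ℝ), ∃ j, ∀ ε > 0, ∃ i, ∀ x, |f x - ψ i x| ≤ ε * ψ j x := by
  obtain ⟨t, hts, htc, htd⟩ :=
    (ContinuousMap.dense_setOfPred_contDiff (E := Space d) (F := ℝ)).exists_countable_dense_subset
  have : Countable t := htc
  have : Nonempty t := htd.nonempty.to_subtype
  let ψ₀ : ℕ × Option t → Space d → ℝ := fun p =>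
    match p.2 with
    | none => cutoff d p.1
    | some g => fun x => cutoff d p.1 x * g.1 x
  obtain ⟨e, he⟩ := exists_surjective_nat (ℕ × Option t)
  refine ⟨fun n => ψ₀ (e n), fun n => ?_, fun n => ?_, fun f => ?_⟩
  · change ContDiff ℝ ∞ (ψ₀ (e n))
    rcases e n with ⟨k, _ | g⟩
    · exact (cutoff d k).contDiff
    · exact (cutoff d k).contDiff.mul (hts g.2)
  · change HasCompactSupport (ψ₀ (e n))
    rcases e n with ⟨k, _ | g⟩
    · exact (cutoff d k).hasCompactSupport
    · exact (cutoff d k).hasCompactSupport.mul_right (f' := g.1)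
  · obtain ⟨R, hR⟩ := f.hasCompactSupport.isBounded.subset_closedBall (0 : Space d)
    obtain ⟨n, hn⟩ := exists_nat_ge R
    obtain ⟨j, hj⟩ := he (n, none)
    refine ⟨j, fun ε hε => ?_⟩
    have hopen := ContinuousMap.isOpen_setOfPred_mapsTo
      (isCompact_closedBall (0 : Space d) (n + 2)) (Metric.isOpen_ball (x := (0 : ℝ)) (ε := ε))
    obtain ⟨g, hgt, hg⟩ := htd.exists_mem_open
      (hopen.preimage (continuous_const.sub continuous_id : Continuous fun g => f.toContinuousMap - g))
      ⟨f.toContinuousMap, by intro x _; simpa using hε⟩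
    obtain ⟨i, hi⟩ := he (n, some ⟨g, hgt⟩)
    refine ⟨i, fun x => ?_⟩
    simp only [hi, hj, ψ₀]
    have h1 : f x = cutoff d n x * f x := by
      by_cases hx : x ∈ tsupport f
      · rw [(cutoff d n).one_of_mem_closedBall, one_mul]
        refine Metric.closedBall_subset_closedBall ?_ (hR hx)
        simp only [cutoff]; linarith
      · rw [image_eq_zero_of_notMem_tsupport hx, mul_zero]
    have h2 := (cutoff d n).nonneg (x := x)
    rw [h1, ← mul_sub, abs_mul, abs_of_nonneg h2, mul_comm ε]
    by_cases hx : x ∈ Metric.closedBall (0 : Space d) (n + 2)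
    · have := hg hx
      simp only [Metric.mem_ball, dist_zero_right, Real.norm_eq_abs] at this
      gcongr
      exact this.le
    · have : cutoff d n x = 0 := by
        apply (cutoff d n).zero_of_le_dist
        simp only [Metric.mem_closedBall, not_le] at hx
        simp only [cutoff]; exact hx.le
      simp [this]

/-- A sequence of smooth test functions that induces the vague topology. -/
noncomputable def testFn (d : ℕ) : ℕ → Space d → ℝ := (exists_smooth_family d).choose

lemma contDiff_testFn (n : ℕ) : ContDiff ℝ ∞ (testFn d n) :=
  (exists_smooth_family d).choose_spec.1 n

lemma hasCompactSupport_testFn (n : ℕ) : HasCompactSupport (testFn d n) :=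
  (exists_smooth_family d).choose_spec.2.1 n

/-- The embedding of the configuration space into a countable product of lines. -/
noncomputable def coords (γ : Config d) : ℕ → ℝ := fun n => pairing (testFn d n) γ

lemma isInducing_coords : IsInducing (coords (d := d)) :=
  ⟨topology_eq_induced (fun n => (contDiff_testFn n).continuous) hasCompactSupport_testFn
    (exists_smooth_family d).choose_spec.2.2⟩

instance : SecondCountableTopology (Config d) := isInducing_coords.secondCountableTopology

instance : TopologicalSpace.PseudoMetrizableSpace (Config d) :=
  isInducing_coords.pseudoMetrizableSpace

lemma ext_points {γ γ' : Config d} (h : γ.points = γ'.points) : γ = γ' := Subtype.ext h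

/-- A bump at `x` small enough to miss `γ'` has pairing 0 with `γ'` and at least 1 with `γ`. The
resulting T0 separation is needed for the surjection argument in `measurable_transition`. -/
lemma points_subset_of_inseparable {γ γ' : Config d} (h : Inseparable γ γ') :
    γ.points ⊆ γ'.points := by
  intro x hx
  by_contra hx'
  have hfin := γ'.2 _ (isCompact_closedBall x 1)
  obtain ⟨r, hr, hr'⟩ : ∃ r > 0, Metric.ball x r ⊆ (γ'.1 ∩ Metric.closedBall x 1)ᶜ :=
    Metric.isOpen_iff.1 hfin.isClosed.isOpen_compl x fun hh => hx' hh.1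
  have hr2 : 0 < min r 1 := lt_min hr one_pos
  let b : ContDiffBump x := ⟨min r 1 / 2, min r 1, by positivity, by linarith⟩
  have h0 : pairing b γ' = 0 := by
    refine (hasSum_pairing b.hasCompactSupport γ').unique ?_
    convert hasSum_zero with y
    apply b.zero_of_le_dist
    by_contra hy
    have hy : dist (y : Space d) x < min r 1 := not_le.1 hy
    exact hr' (lt_of_lt_of_le hy (min_le_left _ _) : (y : Space d) ∈ Metric.ball x r)
      ⟨y.2, (lt_of_lt_of_le hy (min_le_right _ _)).le⟩
  have h1 : 1 ≤ pairing b γ := by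
    have := le_hasSum (hasSum_pairing b.hasCompactSupport γ) ⟨x, hx⟩ fun _ _ => b.nonneg
    rwa [b.one_of_mem_closedBall (Metric.mem_closedBall_self b.rIn_pos.le)] at this
  have h2 : pairing b γ = pairing b γ' := Inseparable.eq
    (h.map (continuous_pairing_of_hasCompactSupport b.continuous b.hasCompactSupport))
  linarith

instance : T0Space (Config d) :=
  ⟨fun _ _ h => ext_points
    ((points_subset_of_inseparable h).antisymm (points_subset_of_inseparable h.symm))⟩

lemma measurableSpace_eq_comap :
    (inferInstance : MeasurableSpace (Config d)) = MeasurableSpace.comap coords inferInstance := by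
  have h := borel_comap (f := coords (d := d)) (t := Pi.topologicalSpace)
  rw [← isInducing_coords.eq_induced] at h
  change borel (Config d) = _
  rw [h, ← BorelSpace.measurable_eq]

lemma measurable_coords : Measurable (coords (d := d)) := isInducing_coords.continuous.measurable

lemma measurable_pairing {f : Space d → ℝ} (hf : Continuous f) (hc : HasCompactSupport f) :
    Measurable fun γ : Config d => pairing f γ :=
  (continuous_pairing_of_hasCompactSupport hf hc).measurable

/-- The Borel σ-algebra is pulled back from `ℕ → ℝ` along `coords`, so measurability can be tested
on pairings. -/
lemma measurable_of_pairing {Ω : Type*} [MeasurableSpace Ω] {F : Ω → Config d}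
    (h : ∀ f : Space d → ℝ, Continuous f → HasCompactSupport f →
      Measurable fun o => pairing f (F o)) : Measurable F := by
  have : Measurable (coords ∘ F) := measurable_pi_lambda _ fun n =>
    h _ (contDiff_testFn n).continuous (hasCompactSupport_testFn n)
  intro s hs
  have hs' : MeasurableSet[MeasurableSpace.comap coords inferInstance] s := by
    rw [← measurableSpace_eq_comap]; exact hs
  obtain ⟨t, ht, rfl⟩ := hs'
  exact this ht

/-! ### Local sets of configurations. -/

/-- A set of configurations is `R`-local if it depends only on the points in the ball of
radius `R`. -/
def IsLocal (R : ℝ) (S : Set (Config d)) : Prop :=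
  ∀ γ γ' : Config d, γ.points ∩ Metric.closedBall 0 R = γ'.points ∩ Metric.closedBall 0 R →
    γ ∈ S → γ' ∈ S

lemma IsLocal.mono {R R' : ℝ} (h : R ≤ R') {S : Set (Config d)} (hS : IsLocal R S) :
    IsLocal R' S := by
  intro γ γ' hγ
  refine hS γ γ' ?_
  have : Metric.closedBall (0 : Space d) R = Metric.closedBall 0 R' ∩ Metric.closedBall 0 R :=
    (Set.inter_eq_right.2 (Metric.closedBall_subset_closedBall h)).symm
  rw [this, ← Set.inter_assoc, hγ, Set.inter_assoc]

lemma pairing_eq_of_local {f : Space d → ℝ} {R : ℝ}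
    (hR : Function.support f ⊆ Metric.closedBall 0 R) {γ γ' : Config d}
    (h : γ.points ∩ Metric.closedBall 0 R = γ'.points ∩ Metric.closedBall 0 R) :
    pairing f γ = pairing f γ' := by
  have key : ∀ γ : Config d, pairing f γ =
      ∑' x, (γ.points ∩ Metric.closedBall 0 R).indicator f x := by
    intro γ
    rw [pairing, tsum_subtype, ← Set.indicator_indicator, Set.indicator_eq_self.2 hR]
  rw [key, key, h]

/-- A basic open set constrains finitely many test functions, and one ball contains all their
supports. -/
lemma exists_local_nhds {U : Set (Config d)} (hU : IsOpen U) {γ : Config d} (hγ : γ ∈ U) :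
    ∃ n : ℕ, ∃ W ⊆ U, IsOpen W ∧ IsLocal n W ∧ γ ∈ W := by
  obtain ⟨V, hV, rfl⟩ := isInducing_coords.isOpen_iff.1 hU
  obtain ⟨I, u, hu, hV'⟩ := isOpen_pi_iff.1 hV _ hγ
  have hb : ∀ i, ∃ n : ℕ, Function.support (testFn d i) ⊆ Metric.closedBall 0 (n : ℝ) := by
    intro i
    obtain ⟨R, hR⟩ := (hasCompactSupport_testFn (d := d) i).isBounded.subset_closedBall 0
    obtain ⟨n, hn⟩ := exists_nat_ge R
    exact ⟨n, (subset_tsupport _).trans (hR.trans (Metric.closedBall_subset_closedBall hn))⟩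
  choose r hr using hb
  refine ⟨I.sup r, coords ⁻¹' ((I : Set ℕ).pi u), Set.preimage_mono hV', ?_, ?_, ?_⟩
  · exact (isOpen_set_pi I.finite_toSet fun i hi => (hu i hi).1).preimage
      isInducing_coords.continuous
  · intro γ γ' h hγ i hi
    have : pairing (testFn d i) γ = pairing (testFn d i) γ' :=
      pairing_eq_of_local ((hr i).trans (Metric.closedBall_subset_closedBall
        (by exact_mod_cast Finset.le_sup (f := r) hi))) h
    have h1 := hγ i hi
    rwa [coords, this] at h1
  · exact fun i hi => (hu i hi).2

/-- Every open set is an increasing union of local open sets. -/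
lemma exists_local_exhaustion {U : Set (Config d)} (hU : IsOpen U) :
    ∃ V : ℕ → Set (Config d), Monotone V ∧ (∀ n, IsOpen (V n)) ∧ (∀ n : ℕ, IsLocal n (V n)) ∧
      ⋃ n, V n = U := by
  -- The largest `n`-local open subset of `U`; it grows with `n` because locality persists for
  -- larger radii.
  refine ⟨fun n : ℕ => ⋃₀ {W | W ⊆ U ∧ IsOpen W ∧ IsLocal n W}, fun m n hmn => ?_, fun n => ?_,
    fun n => ?_, ?_⟩
  · exact Set.sUnion_subset_sUnion fun W hW =>
      ⟨hW.1, hW.2.1, hW.2.2.mono (by exact_mod_cast hmn)⟩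
  · exact isOpen_sUnion fun W hW => hW.2.1
  · rintro γ γ' h ⟨W, hW, hγ⟩
    exact ⟨W, hW, hW.2.2 γ γ' h hγ⟩
  · apply subset_antisymm
    · exact Set.iUnion_subset fun n => Set.sUnion_subset fun W hW => hW.1
    · intro γ hγ
      obtain ⟨n, W, hWU, hWo, hWl, hγW⟩ := exists_local_nhds hU hγ
      exact Set.mem_iUnion.2 ⟨n, W, ⟨hWU, hWo, hWl⟩, hγW⟩

end Config

end FreeKawasaki

namespace FreeKawasaki

/-! ### Measurability of configurations given by indexed points. -/

variable {d : ℕ}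

lemma isLocallyFinite_iff {s : Set (Space d)} :
    IsLocallyFinite s ↔ ∀ n : ℕ, (s ∩ Metric.closedBall 0 n).Finite := by
  refine ⟨fun h n => h _ (isCompact_closedBall _ _), fun h K hK => ?_⟩
  obtain ⟨R, hR⟩ := hK.isBounded.subset_closedBall (0 : Space d)
  obtain ⟨n, hn⟩ := exists_nat_ge R
  exact (h n).subset (Set.inter_subset_inter_right _
    (hR.trans (Metric.closedBall_subset_closedBall hn)))

lemma IsLocallyFinite.countable {s : Set (Space d)} (h : IsLocallyFinite s) : s.Countable := by
  have : s = ⋃ n : ℕ, s ∩ Metric.closedBall 0 n := by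
    rw [← Set.inter_iUnion, Metric.iUnion_closedBall_nat, Set.inter_univ]
  rw [this]
  exact Set.countable_iUnion fun n => (isLocallyFinite_iff.1 h n).countable

/-- The indices in `A` that come first among the indices in `A` with the same value of `x`. -/
def firstIndices {ι β : Type*} (e : ι → ℕ) (A : Set ι) (x : ι → β) : Set ι :=
  {i | i ∈ A ∧ ∀ j ∈ A, x j = x i → e i ≤ e j}

section firstIndices

variable {ι β : Type*} {e : ι → ℕ} (he : Function.Injective e) (A : Set ι) (x : ι → β)

include he in
lemma injOn_firstIndices : Set.InjOn x (firstIndices e A x) := fun i hi j hj hij =>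
  he (le_antisymm (hi.2 j hj.1 hij.symm) (hj.2 i hi.1 hij))

lemma image_firstIndices : x '' firstIndices e A x = x '' A := by
  apply subset_antisymm (Set.image_mono fun i hi => hi.1)
  rintro _ ⟨i, hi, rfl⟩
  obtain ⟨j, hj, hmin⟩ := (measure e).wf.has_min {j | j ∈ A ∧ x j = x i} ⟨i, hi, rfl⟩
  exact ⟨j, ⟨hj.1, fun k hk hkj => not_lt.1 (hmin k ⟨hk, hkj.trans hj.2⟩)⟩, hj.2⟩

end firstIndices

lemma measurableSet_setOf_finite {Ω ι : Type*} [MeasurableSpace Ω] [Countable ι] {B : Ω → Set ι}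
    (hB : ∀ i, MeasurableSet {o | i ∈ B o}) : MeasurableSet {o | (B o).Finite} := by
  have : {o | (B o).Finite} = ⋃ s : Finset ι, ⋂ i ∈ (s : Set ι)ᶜ, {o | i ∈ B o}ᶜ := by
    ext o
    simp only [Set.mem_ofPred_eq, Set.mem_iUnion, Set.mem_iInter, Set.mem_compl_iff]
    constructor
    · intro h
      exact ⟨h.toFinset, fun i hi hB => hi (by simpa using hB)⟩
    · rintro ⟨s, hs⟩
      exact s.finite_toSet.subset fun i hi => by_contra fun h => hs i h hi
  rw [this]
  exact .iUnion fun s => .iInter fun i => .iInter fun _ => (hB i).compl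

lemma indicator_family_eq {Ω ι : Type*} (B : Ω → Set ι) (g : Ω → ι → ℝ) (i : ι) :
    (fun o => (B o).indicator (g o) i) = {o | i ∈ B o}.indicator fun o => g o i := by
  funext o
  by_cases h : i ∈ B o
  · rw [Set.indicator_of_mem h, Set.indicator_of_mem (s := {o | i ∈ B o}) h]
  · rw [Set.indicator_of_notMem h, Set.indicator_of_notMem (s := {o | i ∈ B o}) h]

lemma measurable_ncard {Ω ι : Type*} [MeasurableSpace Ω] [Countable ι] {B : Ω → Set ι}
    (hB : ∀ i, MeasurableSet {o | i ∈ B o}) : Measurable fun o => (B o).ncard := by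
  -- Both sides are 0 on infinite sets: `ncard` by convention, the sum because it is not summable.
  have h : (fun o => (B o).ncard) = fun o => ⌊∑' i, (B o).indicator (1 : ι → ℝ) i⌋₊ := by
    funext o
    by_cases hf : (B o).Finite
    · rw [tsum_eq_sum (s := hf.toFinset) (by simp +contextual),
        Finset.sum_congr rfl (g := fun _ => (1 : ℝ)) (by simp +contextual),
        Set.ncard_eq_toFinset_card _ hf]
      simp
    · rw [Set.Infinite.ncard hf, tsum_eq_zero_of_not_summable, Nat.floor_zero]
      intro hs
      apply hf
      have := hs.tendsto_cofinite_zero.eventually_lt_const (zero_lt_one)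
      refine (eventually_cofinite.1 this).subset fun i hi => ?_
      simp [Set.indicator_of_mem hi]
  rw [h]
  refine Nat.measurable_floor.comp (Measurable.tsum fun i => ?_)
  rw [indicator_family_eq B (fun _ => 1)]
  exact measurable_const.indicator (hB i)

namespace Config

lemma points_ofSet {s : Set (Space d)} (h : IsLocallyFinite s) : (ofSet s).points = s := by
  simp [ofSet, h, points]

lemma ofSet_of_not {s : Set (Space d)} (h : ¬ IsLocallyFinite s) : ofSet s = empty d := dif_neg h

lemma ofSet_points (γ : Config d) : ofSet γ.points = γ := ext_points (points_ofSet γ.2)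

lemma pairing_empty (f : Space d → ℝ) : pairing f (empty d) = 0 := by
  simp [pairing, points, empty]

/-- The configuration of the points `x i`, `i ∈ A`. -/
noncomputable def ofIndexed {ι : Type*} (A : Set ι) (x : ι → Space d) : Config d := ofSet (x '' A)

lemma hasSum_pairing_ofIndexed {ι : Type*} {A : Set ι} {x : ι → Space d} (hx : Set.InjOn x A)
    (hA : IsLocallyFinite (x '' A)) {f : Space d → ℝ} (hf : HasCompactSupport f) :
    HasSum (A.indicator fun i => f (x i)) (pairing f (ofIndexed A x)) := by
  have h : HasSum (f ∘ Subtype.val) _ := hasSum_pairing hf (ofIndexed A x)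
  rw [hasSum_subtype_iff_indicator (f := f), ofIndexed, points_ofSet hA,
    ← hasSum_subtype_iff_indicator] at h
  rw [← hasSum_subtype_iff_indicator]
  exact (Equiv.hasSum_iff (Equiv.Set.imageOfInjOn x A hx)).2 h

/-- A configuration is a set, so coinciding points must count once. Keeping only first occurrences
makes the enumeration injective in a measurable way, and pairings become countable sums. Local
finiteness has to be a measurable event as well, because `ofSet` falls back to the empty
configuration. -/
lemma measurable_ofIndexed {Ω ι : Type*} [MeasurableSpace Ω] [Countable ι] {A : Ω → Set ι}
    {x : Ω → ι → Space d} (hA : ∀ i, MeasurableSet {o | i ∈ A o})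
    (hx : ∀ i, Measurable fun o => x o i) : Measurable fun o => ofIndexed (A o) (x o) := by
  obtain ⟨e, he⟩ := exists_injective_nat ι
  set B : Ω → Set ι := fun o => firstIndices e (A o) (x o) with hBdef
  have hB : ∀ i, MeasurableSet {o | i ∈ B o} := by
    intro i
    have : {o | i ∈ B o} = {o | i ∈ A o} ∩
        ⋂ j ∈ {j | ¬ e i ≤ e j}, ({o | j ∈ A o} ∩ {o | x o j = x o i})ᶜ := by
      ext o
      simp only [hBdef, firstIndices, Set.mem_ofPred_eq, Set.mem_inter_iff, Set.mem_iInter,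
        Set.mem_compl_iff, not_and]
      refine and_congr_right fun _ => forall_congr' fun j => ?_
      tauto
    rw [this]
    exact (hA i).inter (.biInter (Set.to_countable _) fun j _ =>
      ((hA j).inter (measurableSet_eq_fun (hx j) (hx i))).compl)
  have hAB : ∀ o, x o '' A o = x o '' B o := fun o => (image_firstIndices _ _).symm
  have hinj : ∀ o, Set.InjOn (x o) (B o) := fun o => injOn_firstIndices he _ _
  set L : Set Ω := {o | IsLocallyFinite (x o '' B o)} with hLdef
  have hL : MeasurableSet L := by
    have : L = ⋂ n : ℕ, {o | {i | i ∈ B o ∧ x o i ∈ Metric.closedBall 0 (n : ℝ)}.Finite} := by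
      ext o
      simp only [hLdef, Set.mem_ofPred_eq, isLocallyFinite_iff, Set.mem_iInter]
      refine forall_congr' fun n => ?_
      rw [← Set.finite_image_iff (f := x o) ((hinj o).mono fun i hi => hi.1)]
      apply iff_of_eq
      congr 1
      ext y
      constructor
      · rintro ⟨⟨i, hi, rfl⟩, h⟩
        exact ⟨i, ⟨hi, h⟩, rfl⟩
      · rintro ⟨i, ⟨hi, h⟩, rfl⟩
        exact ⟨⟨i, hi, rfl⟩, h⟩
    rw [this]
    refine .iInter fun n => measurableSet_setOf_finite fun i => ?_
    exact (hB i).inter (hx i measurableSet_closedBall)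
  refine measurable_of_pairing fun f hf hc => ?_
  have key : (fun o => pairing f (ofIndexed (A o) (x o))) =
      L.indicator fun o => ∑' i, (B o).indicator (fun i => f (x o i)) i := by
    funext o
    by_cases ho : o ∈ L
    · rw [Set.indicator_of_mem ho, (hasSum_pairing_ofIndexed (hinj o) ho hc).tsum_eq, ofIndexed,
        hAB, ofIndexed]
    · rw [Set.indicator_of_notMem ho, ofIndexed, hAB, ofSet_of_not ho, pairing_empty]
  rw [key]
  refine Measurable.indicator (Measurable.tsum fun i => ?_) hL
  rw [indicator_family_eq B fun o i => f (x o i)]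
  exact (hf.measurable.comp (hx i)).indicator (hB i)

instance (γ : Config d) : Countable γ.points := IsLocallyFinite.countable γ.2

end Config

/-! ### Measurability of the dynamics -/

/-- The sum of the jumps up to time `t`. -/
noncomputable def displacement (w : Noise d) (t : ℝ≥0) : Space d :=
  ∑ k ∈ Finset.range (jumpCount w t), (w k).2

lemma measurable_jumpCount (t : ℝ≥0) : Measurable fun w : Noise d => jumpCount w t :=
  measurable_ncard fun _ => measurableSet_le
    (Finset.measurable_sum _ fun k _ => (measurable_pi_apply k).fst) measurable_const

lemma measurable_displacement (t : ℝ≥0) : Measurable fun w : Noise d => displacement w t := by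
  have : Measurable fun p : Noise d × ℕ => ∑ k ∈ Finset.range p.2, (p.1 k).2 :=
    measurable_from_prod_countable_left fun n => by
      change Measurable fun w : Noise d => ∑ k ∈ Finset.range n, (w k).2
      exact Finset.measurable_sum _ fun k _ => (measurable_pi_apply k).snd
  exact this.comp (measurable_id.prodMk (measurable_jumpCount t))

lemma measurable_process (γ : Config d) (t : ℝ≥0) : Measurable fun w => process γ w t := by
  have h := Config.measurable_ofIndexed (A := fun _ : γ.points → Noise d => Set.univ)
    (x := fun w i => particle (w i) i t) (fun i => by simp) fun i =>
      measurable_const.sub ((measurable_displacement t).comp (measurable_pi_apply i))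
  simp only [Config.ofIndexed, Set.image_univ] at h
  exact h

section transition

variable {a : Space d → ℝ} [IsProbabilityMeasure (noiseLaw a)]

instance (t : ℝ≥0) (γ : Config d) : IsProbabilityMeasure (transition a t γ) := by
  have : IsProbabilityMeasure (systemLaw a γ) := by unfold systemLaw; infer_instance
  exact Measure.isProbabilityMeasure_map (measurable_process γ t).aemeasurable

lemma measurable_ofIndexed_particle {ι Ω : Type*} [MeasurableSpace Ω] [Countable ι]
    {A : Ω → Set ι} {x : Ω → ι → Space d} (hA : ∀ i, MeasurableSet {o | i ∈ A o})
    (hx : ∀ i, Measurable fun o => x o i) (t : ℝ≥0) :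
    Measurable fun p : Ω × (ι → Noise d) =>
      Config.ofIndexed (A p.1) fun i => particle (p.2 i) (x p.1 i) t := by
  refine Config.measurable_ofIndexed (fun i => measurable_fst (hA i)) fun i => ?_
  exact ((hx i).comp measurable_fst).sub
    ((measurable_displacement t).comp ((measurable_pi_apply i).comp measurable_snd))

/-- An i.i.d. family restricted along an injection is i.i.d., so the noises may be carried by the
indices instead of the points. The noise space then no longer depends on the configuration. -/
lemma transition_ofIndexed {ι : Type*} [Countable ι] {A : Set ι} {x : ι → Space d}
    (hx : Set.InjOn x A) (hA : IsLocallyFinite (x '' A)) (t : ℝ≥0) :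
    transition a t (Config.ofIndexed A x) = (Measure.infinitePi fun _ : ι => noiseLaw a).map
      fun w => Config.ofIndexed A fun i => particle (w i) (x i) t := by
  set γ := Config.ofIndexed A x with hγ
  have hp : γ.points = x '' A := Config.points_ofSet hA
  have hex : ∀ y : γ.points, ∃ i ∈ A, x i = y := fun y => hp.le y.2
  choose e heA hex using hex
  have he : Function.Injective e := fun y y' h => Subtype.ext (by rw [← hex y, ← hex y', h])
  have hmap := Measure.map_infinitePi_infinitePi_of_inj (P := fun _ : ι => noiseLaw a) he
  rw [transition, systemLaw, ← hmap, Measure.map_map (measurable_process γ t) (by fun_prop)]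
  congr 1
  funext w
  simp only [Function.comp, process, Config.ofIndexed]
  congr 1
  ext z
  constructor
  · rintro ⟨y, rfl⟩
    exact ⟨e y, heA y, by simp only [hex]⟩
  · rintro ⟨i, hi, rfl⟩
    have hy : x i ∈ γ.points := hp ▸ ⟨i, hi, rfl⟩
    refine ⟨⟨x i, hy⟩, ?_⟩
    have : e ⟨x i, hy⟩ = i := hx (heA _) hi (hex _)
    simp only [this]

/-! ### Coding configurations by a standard Borel space. -/

/-- Codes of configurations: enumerations of their points, without repetition, by a set of
natural numbers. -/
def codes (d : ℕ) : Set ((ℕ → Bool) × (ℕ → Space d)) :=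
  {p | Set.InjOn p.2 {n | p.1 n = true} ∧ IsLocallyFinite (p.2 '' {n | p.1 n = true})}

lemma measurableSet_code_mem (n : ℕ) :
    MeasurableSet {p : (ℕ → Bool) × (ℕ → Space d) | n ∈ {n | p.1 n = true}} :=
  measurableSet_eq_fun ((measurable_pi_apply n).comp measurable_fst) measurable_const

lemma measurable_code_val (n : ℕ) :
    Measurable fun p : (ℕ → Bool) × (ℕ → Space d) => p.2 n :=
  (measurable_pi_apply n).comp measurable_snd

lemma measurableSet_codes : MeasurableSet (codes d) := by
  have h1 : MeasurableSet {p : (ℕ → Bool) × (ℕ → Space d) |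
      Set.InjOn p.2 {n | p.1 n = true}} := by
    have : {p : (ℕ → Bool) × (ℕ → Space d) | Set.InjOn p.2 {n | p.1 n = true}} =
        ⋂ i, ⋂ j, ⋂ _ : i ≠ j, ({p | i ∈ {n | p.1 n = true}} ∩ {p | j ∈ {n | p.1 n = true}} ∩
          {p | p.2 i = p.2 j})ᶜ := by
      ext p
      simp only [Set.InjOn, Set.mem_ofPred_eq, Set.mem_iInter, Set.mem_compl_iff,
        Set.mem_inter_iff]
      exact ⟨fun h i j hij hh => hij (h hh.1.1 hh.1.2 hh.2),
        fun h i hi j hj hij => by_contra fun hne => h i j hne ⟨⟨hi, hj⟩, hij⟩⟩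
    rw [this]
    exact .iInter fun i => .iInter fun j => .iInter fun _ => (((measurableSet_code_mem i).inter
      (measurableSet_code_mem j)).inter (measurableSet_eq_fun (measurable_code_val i) (measurable_code_val j))).compl
  have h2 : codes d = {p | Set.InjOn p.2 {n | p.1 n = true}} ∩
      ⋂ m : ℕ, {p | {n | p.1 n = true ∧ p.2 n ∈ Metric.closedBall 0 (m : ℝ)}.Finite} := by
    ext p
    simp only [codes, Set.mem_ofPred_eq, Set.mem_inter_iff, Set.mem_iInter, isLocallyFinite_iff]
    refine and_congr_right fun hp => forall_congr' fun m => ?_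
    rw [← Set.finite_image_iff (f := p.2) (hp.mono fun i hi => hi.1)]
    apply iff_of_eq
    congr 1
    ext y
    constructor
    · rintro ⟨⟨i, hi, rfl⟩, h⟩
      exact ⟨i, ⟨hi, h⟩, rfl⟩
    · rintro ⟨i, ⟨hi, h⟩, rfl⟩
      exact ⟨⟨i, hi, rfl⟩, h⟩
  rw [h2]
  exact h1.inter (.iInter fun m => measurableSet_setOf_finite fun n =>
    (measurableSet_code_mem n).inter (measurable_code_val n measurableSet_closedBall))

lemma exists_code (γ : Config d) :
    ∃ p ∈ codes d, Config.ofIndexed {n | p.1 n = true} p.2 = γ := by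
  classical
  obtain ⟨e, he⟩ := exists_injective_nat γ.points
  let x : ℕ → Space d := fun n => if h : ∃ y, e y = n then h.choose else 0
  have hx : ∀ y, x (e y) = y := fun y => by
    have h : ∃ y', e y' = e y := ⟨y, rfl⟩
    simp only [x, dif_pos h, he h.choose_spec]
  have hset : {n | (fun n => decide (n ∈ Set.range e)) n = true} = Set.range e := by ext; simp
  have himg : x '' Set.range e = γ.points := by
    rw [← Set.range_comp]
    ext z
    constructor
    · rintro ⟨y, rfl⟩
      simp only [Function.comp, hx, y.2]
    · exact fun hz => ⟨⟨z, hz⟩, hx _⟩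
  refine ⟨⟨fun n => decide (n ∈ Set.range e), x⟩, ⟨?_, ?_⟩, ?_⟩
  · simp only [hset]
    rintro _ ⟨y, rfl⟩ _ ⟨y', rfl⟩ h
    rw [hx, hx] at h
    rw [Subtype.ext h]
  · simp only [hset, himg]
    exact γ.2
  · simp only [Config.ofIndexed, hset, himg, Config.ofSet_points]

/-- The transition probabilities depend measurably on the initial configuration. -/
lemma measurable_transition (t : ℝ≥0) : Measurable (transition a t) := by
  have : StandardBorelSpace (codes d) := measurableSet_codes.standardBorel
  let G : codes d → Config d := fun p => Config.ofIndexed {n | p.1.1 n = true} p.1.2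
  have hmem : ∀ n, MeasurableSet {p : codes d | n ∈ {n | p.1.1 n = true}} := fun n =>
    measurable_subtype_coe (measurableSet_code_mem n)
  have hval : ∀ n, Measurable fun p : codes d => p.1.2 n := fun n =>
    (measurable_code_val n).comp measurable_subtype_coe
  have hG : Measurable G := Config.measurable_ofIndexed hmem hval
  have hsurj : Function.Surjective G := fun γ => by
    obtain ⟨p, hp, h⟩ := exists_code γ
    exact ⟨⟨p, hp⟩, h⟩
  -- A measurable surjection from a standard Borel space detects measurability. On codes all noises
  -- live on the fixed space `ℕ → Noise d`, and the law is a pushforward of a product measure.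
  rw [← hG.measurable_comp_iff_of_surjective hsurj]
  have hF := measurable_ofIndexed_particle hmem hval t
  have key : transition a t ∘ G = fun p => Measure.map
      (fun p : codes d × (ℕ → Noise d) => Config.ofIndexed {n | p.1.1.1 n = true}
        fun i => particle (p.2 i) (p.1.1.2 i) t)
      (Measure.map (Prod.mk p) (Measure.infinitePi fun _ : ℕ => noiseLaw a)) := by
    funext p
    rw [Function.comp, transition_ofIndexed p.2.1 p.2.2,
      Measure.map_map hF measurable_prodMk_left]
    rfl
  rw [key]
  exact (Measure.measurable_map _ hF).comp Measurable.map_prodMk_left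

lemma isProbabilityMeasure_oneDimDistribution {μ : Measure (Config d)} [IsProbabilityMeasure μ]
    (t : ℝ≥0) : IsProbabilityMeasure (oneDimDistribution a μ t) := by
  constructor
  rw [oneDimDistribution, Measure.bind_apply .univ (measurable_transition t).aemeasurable]
  simp

end transition

/-! ### Uniqueness of the Poisson measure -/

lemma Config.pairing_sum {ι : Type*} (s : Finset ι) (c : ι → ℝ) {f : ι → Space d → ℝ}
    (hf : ∀ i ∈ s, HasCompactSupport (f i)) (γ : Config d) :
    pairing (fun x => ∑ i ∈ s, c i * f i x) γ = ∑ i ∈ s, c i * pairing (f i) γ :=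
  (hasSum_sum fun i hi => (hasSum_pairing (hf i hi) γ).mul_left (c i)).tsum_eq

lemma hasCompactSupport_sum {ι : Type*} (s : Finset ι) {f : ι → Space d → ℝ}
    (hf : ∀ i ∈ s, HasCompactSupport (f i)) : HasCompactSupport fun x => ∑ i ∈ s, f i x := by
  induction s using Finset.cons_induction with
  | empty => exact HasCompactSupport.zero
  | cons i s hi ih =>
    simp only [Finset.sum_cons]
    exact (hf i (by simp)).add (ih fun j hj => hf j (by simp [hj]))

lemma Config.pairing_const_mul (c : ℝ) (f : Space d → ℝ) (γ : Config d) :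
    pairing (fun x => c * f x) γ = c * pairing f γ := tsum_mul_left

variable {z : Space d → ℝ} {π π' : Measure (Config d)}

lemma IsPoisson.mgf_pairing (h : IsPoisson z π) {φ : Space d → ℝ} (hφ : ContDiff ℝ ∞ φ)
    (hc : HasCompactSupport φ) (u : ℝ) :
    mgf (Config.pairing φ) π u = Real.exp (∫ x, (Real.exp (u * φ x) - 1) * z x) := by
  rw [← h.2 (fun x => u * φ x) (contDiff_const.mul hφ) hc.mul_left, mgf]
  simp only [Config.pairing_const_mul]

/-- A non-integrable function has Bochner integral 0, whereas the prescribed transform is positive;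
integrability is thus implicit in `IsPoisson`. -/
lemma IsPoisson.integrableExpSet_pairing (h : IsPoisson z π) {φ : Space d → ℝ}
    (hφ : ContDiff ℝ ∞ φ) (hc : HasCompactSupport φ) :
    integrableExpSet (Config.pairing φ) π = Set.univ := by
  refine Set.eq_univ_of_forall fun u => ?_
  have h1 := h.mgf_pairing hφ hc u
  by_contra hu
  rw [mgf, integral_undef hu] at h1
  exact (Real.exp_pos _).ne h1

/-- The moment generating functions agree and are finite on the whole real line, so by analytic
continuation they agree at the imaginary unit. -/
lemma IsPoisson.integral_cexp_pairing_eq (h : IsPoisson z π) (h' : IsPoisson z π')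
    {φ : Space d → ℝ} (hφ : ContDiff ℝ ∞ φ) (hc : HasCompactSupport φ) :
    ∫ γ, Complex.exp (Config.pairing φ γ * Complex.I) ∂π =
      ∫ γ, Complex.exp (Config.pairing φ γ * Complex.I) ∂π' := by
  have := h.1
  have := h'.1
  have hmgf : mgf (Config.pairing φ) π = mgf (Config.pairing φ) π' := by
    funext u
    rw [h.mgf_pairing hφ hc, h'.mgf_pairing hφ hc]
  have := eqOn_complexMGF_of_mgf hmgf (x := Complex.I)
    (by simp [h.integrableExpSet_pairing hφ hc])
  simpa only [complexMGF, mul_comm Complex.I] using this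

theorem IsPoisson.unique (h : IsPoisson z π) (h' : IsPoisson z π') : π = π' := by
  have := h.1
  have := h'.1
  have hm := Config.measurable_coords (d := d)
  have key : π.map Config.coords = π'.map Config.coords := by
    refine IsProjectiveLimit.unique (P := fun I : Finset ℕ => (π.map Config.coords).map I.restrict)
      (fun I => rfl) (fun I => ?_)
    change _ = (π.map Config.coords).map I.restrict
    have hr : Measurable (I.restrict (π := fun _ => ℝ)) := by fun_prop
    have : IsProbabilityMeasure (π.map Config.coords) :=
      Measure.isProbabilityMeasure_map hm.aemeasurable
    have : IsProbabilityMeasure (π'.map Config.coords) :=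
      Measure.isProbabilityMeasure_map hm.aemeasurable
    refine Measure.ext_of_charFunDual (funext fun L => ?_)
    rw [Measure.map_map hr hm, Measure.map_map hr hm, charFunDual_apply, charFunDual_apply,
      integral_map (hr.comp hm).aemeasurable (by fun_prop),
      integral_map (hr.comp hm).aemeasurable (by fun_prop)]
    -- A linear functional of finitely many coordinates is the pairing with one smooth test
    -- function, so the transform fixes all finite-dimensional characteristic functions.
    have hL : ∀ γ : Config d, L ((I.restrict ∘ Config.coords) γ) = Config.pairing
        (fun x => ∑ i : I, L (Pi.single i 1) * Config.testFn d i x) γ := by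
      intro γ
      rw [Config.pairing_sum _ _ fun i _ => Config.hasCompactSupport_testFn _]
      conv_lhs => rw [← ContinuousLinearMap.coe_coe, LinearMap.pi_apply_eq_sum_univ]
      refine Finset.sum_congr rfl fun i _ => ?_
      rw [smul_eq_mul, mul_comm]
      refine congrArg₂ (· * ·) (congrArg L (funext fun j => ?_)) rfl
      simp [Pi.single_apply, eq_comm]
    simp only [hL]
    refine (h.integral_cexp_pairing_eq h' ?_ ?_).symm
    · exact ContDiff.sum fun i _ => contDiff_const.mul (Config.contDiff_testFn _)
    · exact hasCompactSupport_sum _ fun i _ => (Config.hasCompactSupport_testFn _).mul_left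
  ext s hs
  have hs' : MeasurableSet[MeasurableSpace.comap Config.coords inferInstance] s := by
    rw [← Config.measurableSpace_eq_comap]; exact hs
  obtain ⟨t, ht, rfl⟩ := hs'
  rw [← Measure.map_apply hm ht, key, Measure.map_apply hm ht]

/-- Uniqueness makes the choice in `poissonField` harmless, so any explicit construction may replace
it. -/
lemma poissonField_eq (h : IsPoisson z π) : poissonField z = π := by
  have hex : ∃ π : Measure (Config d), IsPoisson z π := ⟨π, h⟩
  rw [poissonField, dif_pos hex]
  exact hex.choose_spec.unique h

/-! ### Construction of Poisson measures -/

lemma lintegral_pow_poissonMeasure (r : ℝ≥0) {c : ℝ} (hc : 0 ≤ c) :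
    ∫⁻ n, ENNReal.ofReal c ^ n ∂(poissonMeasure r) = ENNReal.ofReal (Real.exp (r * (c - 1))) := by
  have hs : HasSum (fun n : ℕ => Real.exp (-r) * r ^ n / n.factorial * c ^ n)
      (Real.exp (r * (c - 1))) := by
    have h := (NormedSpace.expSeries_div_hasSum_exp (𝔸 := ℝ) (r * c)).mul_left (Real.exp (-r))
    rw [← Real.exp_eq_exp_ℝ, ← Real.exp_add] at h
    have e : (r : ℝ) * (c - 1) = -r + r * c := by ring
    rw [e]
    have e' : (fun n : ℕ => Real.exp (-r) * r ^ n / n.factorial * c ^ n) =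
        fun n : ℕ => Real.exp (-r) * ((r * c) ^ n / n.factorial) := by
      funext n
      rw [mul_pow]; ring
    rw [e']
    exact h
  rw [poissonMeasure, lintegral_sum_measure, ← hs.tsum_eq,
    ENNReal.ofReal_tsum_of_nonneg (fun n => by positivity) hs.summable]
  refine tsum_congr fun n => ?_
  rw [lintegral_smul_measure, lintegral_dirac, smul_eq_mul, ← ENNReal.ofReal_pow hc,
    ← ENNReal.ofReal_mul (by positivity)]

/-- Independent Poisson numbers `N k` and, independently of them, independent points `x (k, j)`
with laws `ν k`. -/
noncomputable def clusterLaw (m : ℕ → ℝ≥0) (ν : ℕ → Measure (Space d)) :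
    Measure ((ℕ → ℕ) × (ℕ × ℕ → Space d)) :=
  (Measure.infinitePi fun k => poissonMeasure (m k)).prod
    (Measure.infinitePi fun p : ℕ × ℕ => ν p.1)

/-- The indices `(k, j)` with `k ∈ K` and `j < N k`. -/
def active (K : Set ℕ) (N : ℕ → ℕ) : Set (ℕ × ℕ) := {p | p.1 ∈ K ∧ p.2 < N p.1}

lemma measurableSet_active {Ω : Type*} [MeasurableSpace Ω] (K : Set ℕ) {N : Ω → ℕ → ℕ}
    (hN : ∀ k, Measurable fun o => N o k) (p : ℕ × ℕ) :
    MeasurableSet {o | p ∈ active K (N o)} :=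
  (MeasurableSet.const (p.1 ∈ K)).inter (measurableSet_lt measurable_const (hN p.1))

lemma ae_clusterLaw_of_ae {m : ℕ → ℝ≥0} {ν : ℕ → Measure (Space d)}
    {p : (ℕ × ℕ → Space d) → Prop}
    (h : ∀ᵐ x ∂(Measure.infinitePi fun p : ℕ × ℕ => ν p.1), p x) :
    ∀ᵐ o ∂(clusterLaw m ν), p o.2 :=
  Measure.quasiMeasurePreserving_snd.ae h

section cluster

variable {m : ℕ → ℝ≥0} {ν : ℕ → Measure (Space d)} [∀ k, IsProbabilityMeasure (ν k)]

instance : IsProbabilityMeasure (clusterLaw m ν) := by unfold clusterLaw; infer_instance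

lemma ae_injective_infinitePi {ι : Type*} [Countable ι] {ρ : ι → Measure (Space d)}
    [∀ i, IsProbabilityMeasure (ρ i)] [∀ i, NullSingletonClass (ρ i)] :
    ∀ᵐ x ∂(Measure.infinitePi ρ), Function.Injective x := by
  have h : ∀ i j, i ≠ j → ∀ᵐ x ∂(Measure.infinitePi ρ), x i ≠ x j := by
    intro i j hij
    have hp : ∀ᵐ y ∂((ρ i).prod (ρ j)), y.1 ≠ y.2 := by
      rw [Measure.ae_prod_iff_ae_ae (p := fun y : Space d × Space d => y.1 ≠ y.2)
        (measurableSet_eq_fun measurable_fst measurable_snd).compl]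
      refine ae_of_all _ fun y => ?_
      have : (ρ j) {y} = 0 := measure_singleton y
      refine measure_mono_null ?_ this
      intro y' hy'
      simpa [eq_comm] using hy'
    rw [← Measure.infinitePi_map_eval_prod hij] at hp
    exact ae_of_ae_map (p := fun y : Space d × Space d => y.1 ≠ y.2) (by fun_prop) hp
  have h' : ∀ᵐ x ∂(Measure.infinitePi ρ), ∀ i j, i ≠ j → x i ≠ x j := by
    simp_rw [ae_all_iff]
    exact h
  filter_upwards [h'] with x hx i j hij
  by_contra hne
  exact hx i j hne hij

lemma ae_notMem_infinitePi {s : Set (Space d)} {k : ℕ} (hk : ν k s = 0) :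
    ∀ᵐ x ∂(Measure.infinitePi fun p : ℕ × ℕ => ν p.1), ∀ j, x (k, j) ∉ s := by
  rw [ae_all_iff]
  intro j
  have : ∀ᵐ y ∂(ν k), y ∉ s := measure_eq_zero_iff_ae_notMem.1 hk
  rw [← Measure.infinitePi_map_eval (fun p : ℕ × ℕ => ν p.1) (k, j)] at this
  exact ae_of_ae_map (p := fun y : Space d => y ∉ s) (f := fun x : ℕ × ℕ → Space d => x (k, j))
    (Measurable.aemeasurable (by fun_prop)) this

lemma ae_far_infinitePi (hfar : ∀ R : ℝ, ∀ᶠ k in atTop, ν k (Metric.closedBall 0 R) = 0) :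
    ∀ᵐ x ∂(Measure.infinitePi fun p : ℕ × ℕ => ν p.1), ∀ n : ℕ, ∃ k₀, ∀ k ≥ k₀, ∀ j,
      x (k, j) ∉ Metric.closedBall (0 : Space d) n := by
  rw [ae_all_iff]
  intro n
  obtain ⟨k₀, hk₀⟩ := eventually_atTop.1 (hfar n)
  have : ∀ᵐ x ∂(Measure.infinitePi fun p : ℕ × ℕ => ν p.1), ∀ k ≥ k₀, ∀ j,
      x (k, j) ∉ Metric.closedBall (0 : Space d) n := by
    rw [ae_all_iff]
    intro k
    by_cases hk : k₀ ≤ k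
    · filter_upwards [ae_notMem_infinitePi (hk₀ k hk)] with x hx _ using hx
    · exact ae_of_all _ fun x h => absurd h hk
  filter_upwards [this] with x hx using ⟨k₀, hx⟩

lemma isLocallyFinite_image_active {x : ℕ × ℕ → Space d} (K : Set ℕ) (N : ℕ → ℕ)
    (h : ∀ n : ℕ, ∃ k₀, ∀ k ≥ k₀, ∀ j, x (k, j) ∉ Metric.closedBall (0 : Space d) n) :
    IsLocallyFinite (x '' active K N) := by
  rw [isLocallyFinite_iff]
  intro n
  obtain ⟨k₀, hk₀⟩ := h n
  have hfin : {p : ℕ × ℕ | p.1 ∈ Finset.range k₀ ∧ p.2 ∈ Finset.range (N p.1)}.Finite := by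
    refine (((Finset.range k₀).sigma fun k => Finset.range (N k)).image
      fun p => ((p.1, p.2) : ℕ × ℕ)).finite_toSet.subset ?_
    rintro ⟨k, j⟩ hp
    simp only [Set.mem_ofPred_eq, Finset.mem_range] at hp
    simp [hp]
  refine (hfin.image x).subset ?_
  rintro _ ⟨⟨⟨k, j⟩, hp, rfl⟩, hb⟩
  refine ⟨(k, j), ⟨Finset.mem_range.2 ?_, Finset.mem_range.2 hp.2⟩, rfl⟩
  by_contra hk
  exact hk₀ k (not_lt.1 hk) j hb

lemma measurable_ofIndexed_active (K : Set ℕ) : Measurable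
    fun o : (ℕ → ℕ) × (ℕ × ℕ → Space d) => Config.ofIndexed (active K o.1) o.2 :=
  Config.measurable_ofIndexed
    (measurableSet_active K fun k => (measurable_pi_apply k).comp measurable_fst)
    fun i => (measurable_pi_apply i).comp measurable_snd

/-- Given the numbers `N k`, independence of the points yields the product of `c k ^ N k`; the
generating function of the Poisson law then gives the exponential. -/
lemma lintegral_prod_cluster (s : Finset ℕ) {g : Space d → ℝ≥0∞} (hg : Measurable g)
    {c : ℕ → ℝ} (hc : ∀ k, 0 ≤ c k) (hgc : ∀ k, ∫⁻ y, g y ∂(ν k) = ENNReal.ofReal (c k)) :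
    ∫⁻ o, ∏ k ∈ s, ∏ j ∈ Finset.range (o.1 k), g (o.2 (k, j)) ∂(clusterLaw m ν) =
      ENNReal.ofReal (Real.exp (∑ k ∈ s, m k * (c k - 1))) := by
  have hmeas : Measurable fun o : (ℕ → ℕ) × (ℕ × ℕ → Space d) =>
      ∏ k ∈ s, ∏ j ∈ Finset.range (o.1 k), g (o.2 (k, j)) := by
    refine Finset.measurable_prod _ fun k _ => ?_
    have h : Measurable fun q : (ℕ × ℕ → Space d) × ℕ =>
        ∏ j ∈ Finset.range q.2, g (q.1 (k, j)) :=
      measurable_from_prod_countable_left fun n => by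
        change Measurable fun x : ℕ × ℕ → Space d => ∏ j ∈ Finset.range n, g (x (k, j))
        exact Finset.measurable_prod _ fun j _ => hg.comp (measurable_pi_apply _)
    exact h.comp (measurable_snd.prodMk ((measurable_pi_apply k).comp measurable_fst))
  rw [clusterLaw, lintegral_prod _ hmeas.aemeasurable]
  have h1 : ∀ N : ℕ → ℕ, ∫⁻ x, ∏ k ∈ s, ∏ j ∈ Finset.range (N k), g (x (k, j))
      ∂(Measure.infinitePi fun p : ℕ × ℕ => ν p.1) = ∏ k ∈ s, ENNReal.ofReal (c k) ^ (N k) := by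
    intro N
    let r : Finset (ℕ × ℕ) := (s.sigma fun k => Finset.range (N k)).map
      (Equiv.sigmaEquivProd ℕ ℕ).toEmbedding
    have hr : ∀ p : ℕ × ℕ, p ∈ r ↔ p.1 ∈ s ∧ p.2 ∈ Finset.range (N p.1) := by
      rintro ⟨k, j⟩
      simp [r, Finset.mem_map_equiv]
    have h2 : ∀ f : ℕ × ℕ → ℝ≥0∞,
        ∏ k ∈ s, ∏ j ∈ Finset.range (N k), f (k, j) = ∏ p ∈ r, f p := fun f =>
      (Finset.prod_finset_product r s _ hr).symm
    simp_rw [fun x : ℕ × ℕ → Space d => h2 fun p => g (x p)]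
    rw [lintegral_prod_eq_prod_lintegral_of_indepFun
      (μ := Measure.infinitePi fun p : ℕ × ℕ => ν p.1) r (fun p x => g (x p))
      (iIndepFun_infinitePi (X := fun _ => g) fun _ => hg)
      fun p => hg.comp (measurable_pi_apply p)]
    have h3 : ∀ p : ℕ × ℕ, ∫⁻ x, g (x p) ∂(Measure.infinitePi fun p : ℕ × ℕ => ν p.1) =
        ENNReal.ofReal (c p.1) := by
      intro p
      rw [← hgc, ← Measure.infinitePi_map_eval (fun p : ℕ × ℕ => ν p.1) p,
        lintegral_map hg (measurable_pi_apply p)]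
    simp_rw [h3]
    rw [← h2 fun p => ENNReal.ofReal (c p.1)]
    simp
  simp_rw [h1]
  rw [lintegral_prod_eq_prod_lintegral_of_indepFun
      (μ := Measure.infinitePi fun k => poissonMeasure (m k)) s (fun k N => ENNReal.ofReal (c k) ^ (N k))
      (iIndepFun_infinitePi (X := fun k n => ENNReal.ofReal (c k) ^ n) fun _ => .of_discrete)
      fun k => (Measurable.of_discrete (f := fun n => ENNReal.ofReal (c k) ^ n)).comp
        (measurable_pi_apply k)]
  rw [Real.exp_sum, ENNReal.ofReal_prod_of_nonneg fun _ _ => (Real.exp_pos _).le]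
  refine Finset.prod_congr rfl fun k _ => ?_
  rw [← lintegral_pow_poissonMeasure _ (hc k),
    ← Measure.infinitePi_map_eval (fun k => poissonMeasure (m k)) k,
    lintegral_map .of_discrete (measurable_pi_apply k)]

lemma isPoisson_map_clusterLaw [∀ k, NullSingletonClass (ν k)]
    (hfar : ∀ R : ℝ, ∀ᶠ k in atTop, ν k (Metric.closedBall 0 R) = 0)
    {z : Space d → ℝ} (hz : Measurable z) (hz0 : ∀ x, 0 ≤ z x) (hzb : ∃ M : ℝ, ∀ x, z x ≤ M)
    (K : Set ℕ) [DecidablePred (· ∈ K)] (hK : Measure.sum (fun k => if k ∈ K then m k • ν k else 0) =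
      volume.withDensity fun x => ENNReal.ofReal (z x)) :
    IsPoisson z ((clusterLaw m ν).map fun o => Config.ofIndexed (active K o.1) o.2) := by
  refine ⟨Measure.isProbabilityMeasure_map (measurable_ofIndexed_active K).aemeasurable,
    fun φ hφ hc => ?_⟩
  have hφc := hφ.continuous
  obtain ⟨R, hR⟩ := hc.isBounded.subset_closedBall (0 : Space d)
  have hφ0 : ∀ x, x ∉ Metric.closedBall (0 : Space d) R → φ x = 0 := fun x hx =>
    image_eq_zero_of_notMem_tsupport fun h => hx (hR h)
  obtain ⟨k₀, hk₀⟩ := eventually_atTop.1 (hfar R)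
  obtain ⟨B, hB⟩ := hc.exists_bound_of_continuous hφc
  -- By `hfar` only these clusters can meet the support of `φ`, which turns both sides into finite
  -- expressions.
  set s : Finset ℕ := {k ∈ Finset.range k₀ | k ∈ K} with hs
  have hint : ∀ k, Integrable (fun y => Real.exp (φ y)) (ν k) := fun k =>
    Integrable.of_bound (by fun_prop) (Real.exp B) (ae_of_all _ fun y => by
      rw [Real.norm_eq_abs, Real.abs_exp]
      exact Real.exp_le_exp.2 ((le_abs_self _).trans (hB y)))
  have hrhs : ∫ x, (Real.exp (φ x) - 1) * z x =
      ∑ k ∈ s, m k * (∫ y, Real.exp (φ y) ∂(ν k) - 1) := by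
    have hhc : HasCompactSupport fun x => Real.exp (φ x) - 1 :=
      hc.comp_left (g := fun u => Real.exp u - 1) (by simp)
    have hhi : Integrable fun x => (Real.exp (φ x) - 1) * z x := by
      obtain ⟨M, hM⟩ := hzb
      refine (Continuous.integrable_of_hasCompactSupport (by fun_prop) hhc).mul_bdd (c := M)
        hz.aestronglyMeasurable (ae_of_all _ fun x => ?_)
      rw [Real.norm_of_nonneg (hz0 x)]
      exact hM x
    have h1 : ∫ x, (Real.exp (φ x) - 1) * z x = ∫ x, (Real.exp (φ x) - 1)
        ∂(volume.withDensity fun x => ENNReal.ofReal (z x)) := by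
      rw [integral_withDensity_eq_integral_toReal_smul (by fun_prop)
        (ae_of_all _ fun x => ENNReal.ofReal_lt_top)]
      refine integral_congr_ae (ae_of_all _ fun x => ?_)
      simp only [ENNReal.toReal_ofReal (hz0 x), smul_eq_mul, mul_comm]
    have h2 : Integrable (fun x => Real.exp (φ x) - 1)
        (volume.withDensity fun x => ENNReal.ofReal (z x)) := by
      rw [integrable_withDensity_iff (by fun_prop) (ae_of_all _ fun x => ENNReal.ofReal_lt_top)]
      simpa only [ENNReal.toReal_ofReal (hz0 _)] using hhi
    rw [h1, ← hK]
    rw [← hK] at h2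
    refine (hasSum_integral_measure h2).unique ?_
    have h3 : ∀ k, ∫ x, (Real.exp (φ x) - 1) ∂(if k ∈ K then m k • ν k else 0) =
        if k ∈ s then m k * (∫ y, Real.exp (φ y) ∂(ν k) - 1) else 0 := by
      intro k
      by_cases hkK : k ∈ K
      · have h4 : ∫ x, (Real.exp (φ x) - 1) ∂(ν k) = ∫ y, Real.exp (φ y) ∂(ν k) - 1 := by
          rw [integral_sub (hint k) (integrable_const _)]; simp
        rw [if_pos hkK, integral_smul_nnreal_measure, h4]
        by_cases hk : k < k₀
        · rw [if_pos (by simp [hs, hk, hkK])]; rfl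
        · rw [if_neg (by simp [hs, hk]), ← h4]
          have h5 : ∫ x, (Real.exp (φ x) - 1) ∂(ν k) = 0 := by
            refine integral_eq_zero_of_ae ?_
            have : ∀ᵐ y ∂(ν k), y ∉ Metric.closedBall (0 : Space d) R :=
              measure_eq_zero_iff_ae_notMem.1 (hk₀ k (not_lt.1 hk))
            filter_upwards [this] with y hy
            simp [hφ0 y hy]
          rw [h5, smul_zero]
      · rw [if_neg hkK, if_neg (by simp [hs, hkK])]; simp
    simp_rw [h3]
    have h6 := hasSum_sum_of_ne_finset_zero (L := .unconditional ℕ)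
      (f := fun k => if k ∈ s then m k * (∫ y, Real.exp (φ y) ∂(ν k) - 1) else 0) (s := s)
      (fun k hk => if_neg hk)
    rwa [Finset.sum_congr rfl fun k hk => if_pos hk] at h6
  have hae : ∀ᵐ o ∂(clusterLaw m ν), ENNReal.ofReal
      (Real.exp (Config.pairing φ (Config.ofIndexed (active K o.1) o.2))) =
      ∏ k ∈ s, ∏ j ∈ Finset.range (o.1 k), ENNReal.ofReal (Real.exp (φ (o.2 (k, j)))) := by
    have hR' : ∀ᵐ x ∂(Measure.infinitePi fun p : ℕ × ℕ => ν p.1), ∀ k ≥ k₀, ∀ j,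
        x (k, j) ∉ Metric.closedBall (0 : Space d) R := by
      rw [ae_all_iff]
      intro k
      by_cases hk : k₀ ≤ k
      · filter_upwards [ae_notMem_infinitePi (hk₀ k hk)] with x hx _
          using hx
      · exact ae_of_all _ fun x h => absurd h hk
    filter_upwards [ae_clusterLaw_of_ae ae_injective_infinitePi,
      ae_clusterLaw_of_ae (ae_far_infinitePi hfar), ae_clusterLaw_of_ae hR'] with o h1 h2 h3
    have hsum := Config.hasSum_pairing_ofIndexed h1.injOn
      (isLocallyFinite_image_active K o.1 h2) hc
    let r : Finset (ℕ × ℕ) := (s.sigma fun k => Finset.range (o.1 k)).map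
      (Equiv.sigmaEquivProd ℕ ℕ).toEmbedding
    have hr : ∀ p : ℕ × ℕ, p ∈ r ↔ p.1 ∈ s ∧ p.2 ∈ Finset.range (o.1 p.1) := by
      rintro ⟨k, j⟩
      simp [r, Finset.mem_map_equiv]
    have hsum' := hasSum_sum_of_ne_finset_zero (L := .unconditional (ℕ × ℕ))
      (f := (active K o.1).indicator fun i => φ (o.2 i)) (s := r) (by
        rintro ⟨k, j⟩ hp
        by_cases hA : (k, j) ∈ active K o.1
        · rw [Set.indicator_of_mem hA]
          refine hφ0 _ (h3 k ?_ j)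
          by_contra hk
          exact hp ((hr _).2 ⟨by simp [hs, not_le.1 hk, hA.1], Finset.mem_range.2 hA.2⟩)
        · rw [Set.indicator_of_notMem hA])
    rw [hsum.unique hsum', Real.exp_sum, ENNReal.ofReal_prod_of_nonneg
      fun _ _ => (Real.exp_pos _).le, Finset.prod_finset_product r s (fun k => Finset.range (o.1 k)) hr]
    refine Finset.prod_congr rfl fun k hk => Finset.prod_congr rfl fun j hj => ?_
    rw [Set.indicator_of_mem (show (k, j) ∈ active K o.1 from
      ⟨(Finset.mem_filter.1 hk).2, Finset.mem_range.1 hj⟩)]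
  have hexp : Measurable fun γ : Config d => Real.exp (Config.pairing φ γ) :=
    Real.continuous_exp.measurable.comp (Config.measurable_pairing hφc hc)
  rw [hrhs, integral_map (measurable_ofIndexed_active K).aemeasurable hexp.aestronglyMeasurable,
    integral_eq_lintegral_of_nonneg_ae (ae_of_all _ fun _ => (Real.exp_pos _).le)
    (hexp.comp (measurable_ofIndexed_active K)).aestronglyMeasurable,
    lintegral_congr_ae hae, lintegral_prod_cluster s (g := fun y => ENNReal.ofReal (Real.exp (φ y)))
      (c := fun k => ∫ y, Real.exp (φ y) ∂(ν k)) (by fun_prop)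
      (fun k => integral_nonneg fun y => (Real.exp_pos _).le)
      (fun k => (ofReal_integral_eq_lintegral_ofReal (hint k)
        (ae_of_all _ fun y => (Real.exp_pos _).le)).symm),
    ENNReal.toReal_ofReal (Real.exp_pos _).le]

end cluster

/-! ### Spreading of random walks -/

/-- Modulus one would force `exp (i u x)` to be almost surely constant, hence `ρ` to sit on a
translate of the lattice of step `2π / u`. That set is countable, so null for an atomless law. -/
lemma norm_charFun_lt_one {ρ : Measure ℝ} [IsProbabilityMeasure ρ] [NullSingletonClass ρ] {u : ℝ}
    (hu : u ≠ 0) : ‖charFun ρ u‖ < 1 := by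
  have hle : ∀ᵐ x : ℝ ∂ρ, ‖Complex.exp (u * x * Complex.I)‖ ≤ 1 := ae_of_all _ fun x => by
    rw [← Complex.ofReal_mul, Complex.norm_exp_ofReal_mul_I]
  rcases ae_eq_const_or_norm_integral_lt_of_norm_le_const hle with h | h
  · exfalso
    set c : ℂ := ⨍ x : ℝ, Complex.exp (u * x * Complex.I) ∂ρ with hcdef
    have hcount : {x : ℝ | Complex.exp (u * x * Complex.I) = c}.Countable := by
      rcases Set.eq_empty_or_nonempty {x : ℝ | Complex.exp (u * x * Complex.I) = c} with h0 | h0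
      · rw [h0]; exact Set.countable_empty
      · obtain ⟨x₀, hx₀⟩ := h0
        refine (Set.countable_range fun n : ℤ => x₀ + n * (2 * Real.pi) / u).mono fun x hx => ?_
        have hxx : Complex.exp (u * x * Complex.I) = Complex.exp (u * x₀ * Complex.I) :=
          hx.trans hx₀.symm
        obtain ⟨n, hn⟩ := Complex.exp_eq_exp_iff_exists_int.1 hxx
        refine ⟨n, ?_⟩
        have h1 : (u * x : ℂ) = u * x₀ + n * (2 * Real.pi) := by
          apply mul_right_cancel₀ Complex.I_ne_zero
          rw [hn]; ring
        have h2 : u * x = u * x₀ + n * (2 * Real.pi) := by exact_mod_cast h1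
        field_simp
        linarith
    have h3 : ∀ᵐ x ∂ρ, x ∉ {x : ℝ | Complex.exp (u * x * Complex.I) = c} :=
      measure_eq_zero_iff_ae_notMem.1 (hcount.measure_zero ρ)
    obtain ⟨x, hx, hx'⟩ := (h.and h3).exists
    exact hx' hx
  · rw [charFun_apply_real]
    simpa using h

/-- The Gaussian kernel is itself the characteristic function of a Gaussian law. After Fubini the
centre `y` enters only through a phase, so the bound is uniform in `y`. -/
lemma integral_exp_neg_sq_le {σ : Measure ℝ} [IsProbabilityMeasure σ] (y : ℝ) :
    ∫ s, Real.exp (-(s - y) ^ 2 / 2) ∂σ ≤ ∫ u, ‖charFun σ u‖ ∂(gaussianReal 0 1) := by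
  set g := gaussianReal 0 1
  have h1 : ((∫ s, Real.exp (-(s - y) ^ 2 / 2) ∂σ : ℝ) : ℂ) =
      ∫ u, Complex.exp (-(u * y * Complex.I)) * charFun σ u ∂g := by
    calc ((∫ s, Real.exp (-(s - y) ^ 2 / 2) ∂σ : ℝ) : ℂ)
        = ∫ s, (Real.exp (-(s - y) ^ 2 / 2) : ℂ) ∂σ := integral_complex_ofReal.symm
      _ = ∫ s, ∫ u, Complex.exp (-(u * y * Complex.I)) * Complex.exp (u * s * Complex.I) ∂g ∂σ := by
          refine integral_congr_ae (ae_of_all _ fun s => ?_)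
          have h := charFun_gaussianReal (μ := 0) (v := 1) (s - y)
          rw [charFun_apply_real] at h
          have e1 : ∀ u : ℝ, Complex.exp (-(u * y * Complex.I)) * Complex.exp (u * s * Complex.I) =
              Complex.exp ((s - y : ℝ) * u * Complex.I) := fun u => by
            rw [← Complex.exp_add]; push_cast; ring_nf
          simp only [e1]
          rw [h]
          push_cast
          ring_nf
      _ = ∫ u, ∫ s, Complex.exp (-(u * y * Complex.I)) * Complex.exp (u * s * Complex.I) ∂σ ∂g := by
          refine integral_integral_swap (Integrable.of_bound (by fun_prop) 1
            (ae_of_all _ fun p => ?_))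
          simp only [Function.uncurry]
          rw [norm_mul, ← neg_mul, ← Complex.ofReal_mul, ← Complex.ofReal_neg, ← Complex.ofReal_mul,
            Complex.norm_exp_ofReal_mul_I, Complex.norm_exp_ofReal_mul_I, one_mul]
      _ = ∫ u, Complex.exp (-(u * y * Complex.I)) * charFun σ u ∂g := by
          simp_rw [integral_const_mul, charFun_apply_real]
  have h2 : 0 ≤ ∫ s, Real.exp (-(s - y) ^ 2 / 2) ∂σ := integral_nonneg fun s => (Real.exp_pos _).le
  rw [← Real.norm_of_nonneg h2, ← Complex.norm_real, h1]
  refine (norm_integral_le_integral_norm _).trans (le_of_eq ?_)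
  refine integral_congr_ae (ae_of_all _ fun u => ?_)
  simp only
  rw [norm_mul, ← neg_mul, ← Complex.ofReal_mul, ← Complex.ofReal_neg,
    Complex.norm_exp_ofReal_mul_I, one_mul]

lemma measureReal_closedBall_le {σ : Measure ℝ} [IsProbabilityMeasure σ] (y R : ℝ) :
    σ.real (Metric.closedBall y R) ≤
      Real.exp (R ^ 2 / 2) * ∫ u, ‖charFun σ u‖ ∂(gaussianReal 0 1) := by
  have hi : Integrable (fun s => Real.exp (-(s - y) ^ 2 / 2)) σ :=
    Integrable.of_bound (by fun_prop) 1 (ae_of_all _ fun s => by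
      rw [Real.norm_eq_abs, Real.abs_exp, Real.exp_le_one_iff]
      nlinarith [sq_nonneg (s - y)])
  have h1 : Real.exp (-R ^ 2 / 2) * σ.real (Metric.closedBall y R) ≤
      ∫ s, Real.exp (-(s - y) ^ 2 / 2) ∂σ := by
    refine le_trans ?_ (mul_meas_ge_le_integral_of_nonneg (ae_of_all _ fun s => (Real.exp_pos _).le)
      hi (Real.exp (-R ^ 2 / 2)))
    gcongr
    · finiteness
    · intro s hs
      rw [Metric.mem_closedBall, Real.dist_eq] at hs
      have : (s - y) ^ 2 ≤ R ^ 2 := sq_le_sq' (by linarith [(abs_le.1 hs).1]) (abs_le.1 hs).2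
      exact Real.exp_le_exp.2 (by linarith)
  have h2 := h1.trans (integral_exp_neg_sq_le y)
  calc σ.real (Metric.closedBall y R)
      = Real.exp (R ^ 2 / 2) * (Real.exp (-R ^ 2 / 2) * σ.real (Metric.closedBall y R)) := by
        rw [← mul_assoc, ← Real.exp_add, neg_div, add_neg_cancel, Real.exp_zero, one_mul]
    _ ≤ _ := by gcongr

lemma charFun_map_sum_range {E : Type*} [MeasurableSpace E] {ρ : Measure E}
    [IsProbabilityMeasure ρ] {f : E → ℝ} (hf : Measurable f) (n : ℕ) (u : ℝ) :
    charFun ((Measure.infinitePi fun _ : ℕ => ρ).map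
      fun ξ => ∑ k ∈ Finset.range n, f (ξ k)) u = charFun (ρ.map f) u ^ n := by
  have hind := iIndepFun_infinitePi (P := fun _ : ℕ => ρ) (X := fun _ => f) fun _ => hf
  have h := (hind.restrict (Finset.range n)).charFun_map_finsetSum_eq_prod
    (s := Finset.range n) fun k _ => (hf.comp (measurable_pi_apply k)).aemeasurable
  have h1 : (fun ξ : ℕ → E => ∑ k ∈ Finset.range n, f (ξ k)) =
      ∑ k ∈ Finset.range n, fun ξ : ℕ → E => f (ξ k) := by
    ext; simp
  have h2 : ∀ k : ℕ, (Measure.infinitePi fun _ : ℕ => ρ).map (fun ξ => f (ξ k)) = ρ.map f := by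
    intro k
    conv_rhs => rw [← Measure.infinitePi_map_eval (fun _ : ℕ => ρ) k,
      Measure.map_map hf (by fun_prop)]
    rfl
  have h' : charFun ((Measure.infinitePi fun _ : ℕ => ρ).map
      (∑ k ∈ Finset.range n, fun ξ : ℕ → E => f (ξ k))) = ∏ k ∈ Finset.range n,
        charFun ((Measure.infinitePi fun _ : ℕ => ρ).map fun ξ => f (ξ k)) := h
  rw [h1, h']
  simp [h2]

lemma tendsto_integral_norm_charFun_pow {ρ : Measure ℝ} [IsProbabilityMeasure ρ]
    [NullSingletonClass ρ] : Tendsto (fun n : ℕ => ∫ u, ‖charFun ρ u‖ ^ n ∂(gaussianReal 0 1))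
      atTop (𝓝 0) := by
  have : NullSingletonClass (gaussianReal 0 1) := nullSingletonClass_gaussianReal one_ne_zero
  suffices h : Tendsto (fun n : ℕ => ∫ u, ‖charFun ρ u‖ ^ n ∂(gaussianReal 0 1)) atTop
      (𝓝 (∫ _, (0 : ℝ) ∂(gaussianReal 0 1))) by simpa using h
  refine tendsto_integral_of_dominated_convergence (fun _ : ℝ => (1 : ℝ)) (fun n => ?_)
    (integrable_const _) (fun n => ae_of_all _ fun u => ?_) ?_
  · exact (measurable_charFun.norm.pow_const n).aestronglyMeasurable
  · rw [Real.norm_of_nonneg (by positivity)]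
    exact pow_le_one₀ (norm_nonneg _) (norm_charFun_le_one _)
  · have h0 : ∀ᵐ u ∂(gaussianReal 0 1), u ∉ ({0} : Set ℝ) :=
      measure_eq_zero_iff_ae_notMem.1 (measure_singleton 0)
    filter_upwards [h0] with u hu
    exact tendsto_pow_atTop_nhds_zero_of_lt_one (norm_nonneg _) (norm_charFun_lt_one hu)

/-- The partial sums of i.i.d. vectors with an absolutely continuous law leave all balls of a given
radius, uniformly in the centre. -/
lemma exists_bound_sum_mem_closedBall {ρ : Measure (Space d)} [IsProbabilityMeasure ρ]
    (hρ : ρ ≪ volume) (i : Fin d) (R : ℝ) : ∃ q : ℕ → ℝ≥0∞, Tendsto q atTop (𝓝 0) ∧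
      ∀ n x, (Measure.infinitePi fun _ : ℕ => ρ)
        {ξ | x - ∑ k ∈ Finset.range n, ξ k ∈ Metric.closedBall 0 R} ≤ q n := by
  have hf : Measurable fun y : Space d => y i := by fun_prop
  have : IsProbabilityMeasure (ρ.map fun y => y i) :=
    Measure.isProbabilityMeasure_map hf.aemeasurable
  -- One coordinate is enough to see the spreading; its law has no atoms because hyperplanes are
  -- Lebesgue null.
  have : NullSingletonClass (ρ.map fun y => y i) := by
    refine ⟨fun c => ?_⟩
    rw [Measure.map_apply hf (measurableSet_singleton c)]
    refine hρ ?_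
    have h := (PiLp.volume_preserving_ofLp (Fin d)).measure_preimage
      (s := {f : Fin d → ℝ | f i = c})
      (measurableSet_eq_fun (measurable_pi_apply i) measurable_const).nullMeasurableSet
    rw [volume_pi, Measure.pi_hyperplane] at h
    exact h
  refine ⟨fun n => ENNReal.ofReal (Real.exp (R ^ 2 / 2) *
    ∫ u, ‖charFun (ρ.map fun y => y i) u‖ ^ n ∂(gaussianReal 0 1)), ?_, fun n x => ?_⟩
  · have h := (tendsto_integral_norm_charFun_pow (ρ := ρ.map fun y => y i)).const_mul
      (Real.exp (R ^ 2 / 2))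
    rw [mul_zero] at h
    simpa using ENNReal.tendsto_ofReal h
  · set P := Measure.infinitePi fun _ : ℕ => ρ
    have hS : Measurable fun ξ : ℕ → Space d => ∑ k ∈ Finset.range n, (ξ k) i :=
      Finset.measurable_sum _ fun k _ => hf.comp (measurable_pi_apply k)
    have : IsProbabilityMeasure (P.map fun ξ => ∑ k ∈ Finset.range n, (ξ k) i) :=
      Measure.isProbabilityMeasure_map hS.aemeasurable
    have h1 := measureReal_closedBall_le (σ := P.map fun ξ => ∑ k ∈ Finset.range n, (ξ k) i)
      (x i) R
    have h0 : ∀ u, charFun (P.map fun ξ => ∑ k ∈ Finset.range n, (ξ k) i) u =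
        charFun (ρ.map fun y => y i) u ^ n := charFun_map_sum_range hf n
    simp only [h0, norm_pow] at h1
    rw [ENNReal.le_ofReal_iff_toReal_le (by finiteness)
      (le_trans measureReal_nonneg h1)]
    refine le_trans ?_ h1
    rw [measureReal_def, Measure.map_apply hS measurableSet_closedBall]
    refine ENNReal.toReal_mono (by finiteness) (measure_mono fun ξ hξ => ?_)
    rw [Set.mem_ofPred_eq, mem_closedBall_zero_iff] at hξ
    rw [Set.mem_preimage, Metric.mem_closedBall, dist_comm, Real.dist_eq]
    have h2 := (PiLp.norm_apply_le (x - ∑ k ∈ Finset.range n, ξ k) i).trans hξ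
    have h3 : (x - ∑ k ∈ Finset.range n, ξ k) i = x i - ∑ k ∈ Finset.range n, (ξ k) i := by
      simp
    rwa [h3] at h2

/-! ### Divergence of the number of jumps -/

lemma measure_Ici_one_expMeasure_pos {r : ℝ} (hr : 0 < r) : 0 < expMeasure r (Set.Ici 1) := by
  have := isProbabilityMeasure_expMeasure hr
  have h1 : (expMeasure r).real (Set.Iic 1) = 1 - Real.exp (-(r * 1)) := by
    rw [← cdf_eq_real, cdf_expMeasure_eq hr, if_pos zero_le_one]
  have h2 : 0 < (expMeasure r).real (Set.Ioi 1) := by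
    rw [← Set.compl_Iic, probReal_compl_eq_one_sub measurableSet_Iic, h1]
    linarith [Real.exp_pos (-(r * 1))]
  refine lt_of_lt_of_le (ENNReal.toReal_pos_iff.1 h2).1 (measure_mono Set.Ioi_subset_Ici_self)

lemma ae_nonneg_expMeasure {r : ℝ} (hr : 0 < r) : ∀ᵐ x ∂(expMeasure r), 0 ≤ x := by
  have := isProbabilityMeasure_expMeasure hr
  have h1 : (expMeasure r).real (Set.Iic 0) = 0 := by
    rw [← cdf_eq_real, cdf_expMeasure_eq hr, if_pos le_rfl]; simp
  rw [measureReal_eq_zero_iff] at h1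
  filter_upwards [measure_eq_zero_iff_ae_notMem.1 h1] with x hx
  exact (not_le.1 hx).le

/-- By the second Borel–Cantelli lemma infinitely many waiting times are at least 1, and all are
nonnegative. -/
lemma ae_tendsto_sum_expMeasure {r : ℝ} (hr : 0 < r) :
    ∀ᵐ τ ∂(Measure.infinitePi fun _ : ℕ => expMeasure r), (∀ k, 0 ≤ τ k) ∧
      Tendsto (fun n => ∑ k ∈ Finset.range (n + 1), τ k) atTop atTop := by
  have := isProbabilityMeasure_expMeasure hr
  set P := Measure.infinitePi fun _ : ℕ => expMeasure r
  have h0 : ∀ᵐ τ ∂P, ∀ k, 0 ≤ τ k := by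
    rw [ae_all_iff]
    intro k
    have h := ae_nonneg_expMeasure hr
    rw [← Measure.infinitePi_map_eval (fun _ : ℕ => expMeasure r) k] at h
    exact ae_of_ae_map (f := fun τ : ℕ → ℝ => τ k) (Measurable.aemeasurable (by fun_prop)) h
  let s : ℕ → Set (ℕ → ℝ) := fun k => {τ | τ k ∈ Set.Ici 1}
  have hsm : ∀ k, MeasurableSet (s k) := fun k => measurable_pi_apply k measurableSet_Ici
  have hsP : ∀ k, P (s k) = expMeasure r (Set.Ici 1) := fun k => by
    rw [← Measure.infinitePi_map_eval (fun _ : ℕ => expMeasure r) k,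
      Measure.map_apply (by fun_prop) measurableSet_Ici]
    rfl
  have hind : iIndepSet s P := by
    rw [iIndepSet_iff_meas_biInter hsm]
    intro I
    have : ⋂ i ∈ I, s i = Set.pi I fun _ => Set.Ici 1 := by
      ext τ; simp [s]
    rw [this, Measure.infinitePi_pi _ fun _ _ => measurableSet_Ici]
    simp_rw [hsP]
  have hlim : P (limsup s atTop) = 1 := by
    refine measure_limsup_eq_one hsm hind ?_
    simp_rw [hsP]
    exact ENNReal.tsum_const_eq_top_of_ne_zero (measure_Ici_one_expMeasure_pos hr).ne'
  have hlim' : ∀ᵐ τ ∂P, τ ∈ limsup s atTop := by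
    rwa [← prob_compl_eq_zero_iff (.measurableSet_limsup hsm), ← mem_ae_iff] at hlim
  filter_upwards [h0, hlim'] with τ hτ hτl
  refine ⟨hτ, ?_⟩
  rw [mem_limsup_iff_frequently_mem] at hτl
  have hmono : Monotone fun n => ∑ k ∈ Finset.range (n + 1), τ k := monotone_nat_of_le_succ
    fun n => by rw [Finset.sum_range_succ _ (n + 1)]; linarith [hτ (n + 1)]
  refine tendsto_atTop_atTop_of_monotone hmono fun b => ?_
  obtain ⟨m, hm⟩ := exists_nat_ge b
  have hinf : {k | τ ∈ s k}.Infinite := Nat.frequently_atTop_iff_infinite.1 hτl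
  obtain ⟨I, hI, hIc⟩ := hinf.exists_subset_card_eq m
  refine ⟨I.sup id, hm.trans ?_⟩
  calc (m : ℝ) = ∑ k ∈ I, (1 : ℝ) := by simp [hIc]
    _ ≤ ∑ k ∈ I, τ k := Finset.sum_le_sum fun k hk => hI hk
    _ ≤ ∑ k ∈ Finset.range (I.sup id + 1), τ k :=
        Finset.sum_le_sum_of_subset_of_nonneg (fun k hk => Finset.mem_range.2
          (Nat.lt_succ_of_le (Finset.le_sup (f := id) hk))) fun k _ _ => hτ k

lemma tendsto_jumpCount {w : Noise d} (h0 : ∀ k, 0 ≤ (w k).1)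
    (h : Tendsto (fun n => ∑ k ∈ Finset.range (n + 1), (w k).1) atTop atTop) :
    Tendsto (jumpCount w) atTop atTop := by
  have hmono : Monotone fun n => ∑ k ∈ Finset.range (n + 1), (w k).1 := monotone_nat_of_le_succ
    fun n => by rw [Finset.sum_range_succ _ (n + 1)]; linarith [h0 (n + 1)]
  rw [tendsto_atTop]
  intro m
  obtain ⟨t₀, ht₀⟩ := exists_nat_ge (∑ k ∈ Finset.range (m + 1), (w k).1)
  filter_upwards [eventually_ge_atTop (t₀ : ℝ≥0)] with t ht
  have ht' : (t₀ : ℝ) ≤ t := by exact_mod_cast ht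
  -- Essential because `ncard` is 0 on infinite sets: divergence of the arrival times rules out
  -- explosion.
  have hfin : {n : ℕ | ∑ k ∈ Finset.range (n + 1), (w k).1 ≤ (t : ℝ)}.Finite := by
    obtain ⟨n₀, hn₀⟩ := (h.eventually_gt_atTop (t : ℝ)).exists_forall_of_atTop
    refine (Set.finite_lt_nat n₀).subset fun n hn => ?_
    by_contra hlt
    exact absurd hn (not_le.2 (hn₀ n (not_lt.1 hlt)))
  rw [jumpCount]
  calc m = (Finset.range m : Set ℕ).ncard := by simp
    _ ≤ _ := Set.ncard_le_ncard (fun n hn => ?_) hfin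
  exact (hmono (Finset.mem_range.1 hn).le).trans (ht₀.trans ht')

/-! ### Escape of a single particle -/

/-- Separates waiting times from jumps, so that Fubini can freeze the number of jumps while the walk
stays random. -/
lemma infinitePi_prod_eq_map {α β : Type*} [MeasurableSpace α] [MeasurableSpace β]
    {μ : Measure α} {ν : Measure β} [IsProbabilityMeasure μ] [IsProbabilityMeasure ν] :
    (Measure.infinitePi fun _ : ℕ => μ.prod ν) =
      ((Measure.infinitePi fun _ : ℕ => μ).prod (Measure.infinitePi fun _ : ℕ => ν)).map
        fun p k => (p.1 k, p.2 k) := by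
  symm
  refine Measure.eq_infinitePi _ fun s t ht => ?_
  have hm : Measurable fun (p : (ℕ → α) × (ℕ → β)) (k : ℕ) => (p.1 k, p.2 k) := by fun_prop
  have hm' : Measurable fun (p : (s → α) × (s → β)) (k : s) => (p.1 k, p.2 k) := by fun_prop
  have hr₁ : Measurable (s.restrict (π := fun _ => α)) := by fun_prop
  have hr₂ : Measurable (s.restrict (π := fun _ => β)) := by fun_prop
  have ht' : MeasurableSet (Set.pi Set.univ fun k : s => t k) := .univ_pi fun k => ht k
  have hset : (fun (p : (ℕ → α) × (ℕ → β)) (k : ℕ) => (p.1 k, p.2 k)) ⁻¹' (Set.pi s t) =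
      Prod.map (s.restrict (π := fun _ => α)) (s.restrict (π := fun _ => β)) ⁻¹'
        ((fun (p : (s → α) × (s → β)) (k : s) => (p.1 k, p.2 k)) ⁻¹'
          (Set.pi Set.univ fun k : s => t k)) := by
    ext p; simp
  have hmp := (measurePreserving_arrowProdEquivProdArrow α β s (fun _ => μ) (fun _ => ν)).symm
  rw [Measure.map_apply hm (.pi s.countable_toSet fun k _ => ht k), hset,
    ← Measure.map_apply (hr₁.prodMap hr₂) (hm' ht'), ← Measure.map_prod_map _ _ hr₁ hr₂,
    Measure.infinitePi_map_restrict, Measure.infinitePi_map_restrict]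
  have h := hmp.measure_preimage ht'.nullMeasurableSet
  rw [Measure.pi_pi, Finset.prod_coe_sort s fun k => (μ.prod ν) (t k)] at h
  exact h

section escape

variable {a : Space d → ℝ}

lemma isProbabilityMeasure_jumpLaw (ha0 : ∀ y, 0 ≤ a y) (ha : 0 < totalRate a) :
    IsProbabilityMeasure (jumpLaw a) := by
  have hi : Integrable a := by
    by_contra h
    rw [totalRate, integral_undef h] at ha
    exact lt_irrefl _ ha
  constructor
  rw [jumpLaw, withDensity_apply _ .univ, setLIntegral_univ,
    ← ofReal_integral_eq_lintegral_ofReal (hi.div_const _)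
      (ae_of_all _ fun x => div_nonneg (ha0 x) ha.le), integral_div]
  rw [← totalRate, div_self ha.ne', ENNReal.ofReal_one]

lemma isProbabilityMeasure_noiseLaw (ha0 : ∀ y, 0 ≤ a y) (ha : 0 < totalRate a) :
    IsProbabilityMeasure (noiseLaw a) := by
  have := isProbabilityMeasure_jumpLaw ha0 ha
  have := isProbabilityMeasure_expMeasure ha
  unfold noiseLaw
  infer_instance

/-- The particles escape from every ball, uniformly in the starting point. -/
lemma exists_bound_particle_mem_closedBall (ha0 : ∀ y, 0 ≤ a y) (ha : 0 < totalRate a)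
    (i : Fin d) (R : ℝ) : ∃ q : ℝ≥0 → ℝ≥0∞, Tendsto q atTop (𝓝 0) ∧
      ∀ t x, noiseLaw a {w | particle w x t ∈ Metric.closedBall 0 R} ≤ q t := by
  have := isProbabilityMeasure_jumpLaw ha0 ha
  have := isProbabilityMeasure_expMeasure ha
  obtain ⟨q, hq, hqb⟩ := exists_bound_sum_mem_closedBall (ρ := jumpLaw a)
    (withDensity_absolutelyContinuous _ _) i R
  -- The count ignores the jumps, so they are filled with 0.
  let Z : ℝ≥0 → (ℕ → ℝ) → ℕ := fun t τ => jumpCount (fun k => (τ k, (0 : Space d))) t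
  have hZ : ∀ t, Measurable (Z t) := fun t => (measurable_jumpCount t).comp (by fun_prop)
  set P := Measure.infinitePi fun _ : ℕ => expMeasure (totalRate a)
  -- The walk bound averaged over the number of jumps; the truncation at 1 supplies the dominating
  -- function.
  refine ⟨fun t => ∫⁻ τ, min (q (Z t τ)) 1 ∂P, ?_, fun t x => ?_⟩
  · rw [← lintegral_zero (μ := P)]
    refine tendsto_lintegral_filter_of_dominated_convergence (fun _ => 1)
      (Eventually.of_forall fun t => ?_)
      (Eventually.of_forall fun t => ae_of_all _ fun τ => min_le_right _ _) (by simp) ?_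
    · exact (Measurable.of_discrete (f := fun n : ℕ => min (q n) 1)).comp (hZ t)
    · filter_upwards [ae_tendsto_sum_expMeasure ha] with τ hτ
      have h1 : Tendsto (fun t => Z t τ) atTop atTop :=
        tendsto_jumpCount (w := fun k => (τ k, (0 : Space d))) hτ.1 hτ.2
      have h2 : Tendsto (fun n => min (q n) 1) atTop (𝓝 (min 0 1)) := hq.min tendsto_const_nhds
      rw [min_eq_left zero_le_one] at h2
      exact h2.comp h1
  · have hm : Measurable fun w : Noise d => particle w x t :=
      measurable_const.sub (measurable_displacement t)
    have hmap : Measurable fun (p : (ℕ → ℝ) × (ℕ → Space d)) (k : ℕ) => (p.1 k, p.2 k) := by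
      fun_prop
    have hs : MeasurableSet {w : Noise d | particle w x t ∈ Metric.closedBall 0 R} :=
      hm measurableSet_closedBall
    rw [noiseLaw, infinitePi_prod_eq_map, Measure.map_apply hmap hs,
      Measure.prod_apply (hmap hs)]
    exact lintegral_mono fun τ => le_min (hqb (Z t τ) x) prob_le_one

end escape

/-! ### Weak convergence and local sets -/

/-- By the portmanteau theorem it suffices to bound `ν` on open sets by a lower limit. Continuity
from below reduces this to local open sets, where the vanishing error `e` transfers the bound from
`P` to `P'`. -/
lemma ConvergesWeakly.of_local {ι : Type} {P P' : ι → Measure (Config d)}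
    [∀ i, IsProbabilityMeasure (P i)] [∀ i, IsProbabilityMeasure (P' i)] {l : Filter ι}
    [l.IsCountablyGenerated] {ν : Measure (Config d)} [IsProbabilityMeasure ν]
    (h : ∀ R : ℝ, ∃ e : ι → ℝ≥0∞, Tendsto e l (𝓝 0) ∧
      ∀ S, MeasurableSet S → Config.IsLocal R S → ∀ i, P i S ≤ P' i S + e i)
    (hP : ConvergesWeakly P l ν) : ConvergesWeakly P' l ν := by
  let Q : ι → ProbabilityMeasure (Config d) := fun i => ⟨P i, inferInstance⟩
  let Q' : ι → ProbabilityMeasure (Config d) := fun i => ⟨P' i, inferInstance⟩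
  let ρ : ProbabilityMeasure (Config d) := ⟨ν, inferInstance⟩
  have hQ : Tendsto Q l (𝓝 ρ) := ProbabilityMeasure.tendsto_iff_forall_integral_tendsto.2 hP
  suffices hQ' : Tendsto Q' l (𝓝 ρ) from
    ProbabilityMeasure.tendsto_iff_forall_integral_tendsto.1 hQ'
  refine tendsto_of_forall_isOpen_le_liminf' fun G hG => ?_
  obtain ⟨V, hVm, hVo, hVl, rfl⟩ := Config.exists_local_exhaustion hG
  rw [hVm.measure_iUnion]
  refine iSup_le fun n => ?_
  obtain ⟨e, he, hle⟩ := h n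
  calc ν (V n) ≤ l.liminf fun i => P i (V n) :=
        ProbabilityMeasure.le_liminf_measure_open_of_tendsto hQ (hVo n)
    _ ≤ l.liminf ((fun i => P' i (⋃ n, V n)) + e) := by
        refine liminf_le_liminf (Eventually.of_forall fun i => ?_)
        refine (hle _ (hVo n).measurableSet (hVl n) i).trans ?_
        exact add_le_add_left (measure_mono (Set.subset_iUnion V n)) _
    _ = l.liminf fun i => P' i (⋃ n, V n) := ENNReal.liminf_add_of_right_tendsto_zero he _

/-- Agreement in the ball is not enough, as `ofSet` empties sets that are not locally finite. A
finite difference makes both sets locally finite or neither, so local finiteness at time `t` need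
not be proved. -/
lemma ofSet_inter_closedBall_eq {s s' : Set (Space d)} {R : ℝ}
    (h : s ∩ Metric.closedBall 0 R = s' ∩ Metric.closedBall 0 R) {F : Set (Space d)}
    (hF : F.Finite) (h₁ : s ⊆ s' ∪ F) (h₂ : s' ⊆ s ∪ F) :
    (Config.ofSet s).points ∩ Metric.closedBall 0 R =
      (Config.ofSet s').points ∩ Metric.closedBall 0 R := by
  have key : ∀ {u v : Set (Space d)}, u ⊆ v ∪ F → IsLocallyFinite v → IsLocallyFinite u :=
    fun hu hv K hK => ((hv K hK).union hF).subset fun x hx => (hu hx.1).imp (fun h => ⟨h, hx.2⟩) id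
  by_cases hs : IsLocallyFinite s
  · rw [Config.points_ofSet hs, Config.points_ofSet (key h₂ hs), h]
  · rw [Config.ofSet_of_not hs, Config.ofSet_of_not fun h' => hs (key h₁ h')]

/-! ### Evolution of the cluster construction -/

section evolution

variable {a : Space d → ℝ} {m : ℕ → ℝ≥0} {ν : ℕ → Measure (Space d)}

/-- The joint law of the initial points and of the noises of the particles. -/
noncomputable def jointLaw (a : Space d → ℝ) (m : ℕ → ℝ≥0) (ν : ℕ → Measure (Space d)) :
    Measure (((ℕ → ℕ) × (ℕ × ℕ → Space d)) × (ℕ × ℕ → Noise d)) :=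
  (clusterLaw m ν).prod (Measure.infinitePi fun _ : ℕ × ℕ => noiseLaw a)

instance [IsProbabilityMeasure (noiseLaw a)] [∀ k, IsProbabilityMeasure (ν k)] :
    IsProbabilityMeasure (jointLaw a m ν) := by unfold jointLaw; infer_instance

/-- The configuration at time `t` of the particles with indices in `active K`. -/
noncomputable def evolved (K : Set ℕ) (t : ℝ≥0)
    (p : ((ℕ → ℕ) × (ℕ × ℕ → Space d)) × (ℕ × ℕ → Noise d)) : Config d :=
  Config.ofIndexed (active K p.1.1) fun i => particle (p.2 i) (p.1.2 i) t

lemma measurable_evolved (K : Set ℕ) (t : ℝ≥0) : Measurable (evolved (d := d) K t) :=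
  measurable_ofIndexed_particle
    (measurableSet_active K fun k => (measurable_pi_apply k).comp measurable_fst)
    (fun i => (measurable_pi_apply i).comp measurable_snd) t

/-- Almost every sample enumerates a locally finite set without repetition, so
`transition_ofIndexed` applies and Fubini merges initial points and noises. -/
lemma oneDimDistribution_map_clusterLaw [IsProbabilityMeasure (noiseLaw a)]
    [∀ k, IsProbabilityMeasure (ν k)] [∀ k, NullSingletonClass (ν k)]
    (hfar : ∀ R : ℝ, ∀ᶠ k in atTop, ν k (Metric.closedBall 0 R) = 0) (K : Set ℕ) (t : ℝ≥0) :
    oneDimDistribution a ((clusterLaw m ν).map fun o => Config.ofIndexed (active K o.1) o.2) t =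
      (jointLaw a m ν).map (evolved K t) := by
  have hT := measurable_transition (a := a) t
  ext S hS
  have hTS : Measurable fun γ => transition a t γ S := (Measure.measurable_coe hS).comp hT
  rw [oneDimDistribution, Measure.bind_apply hS hT.aemeasurable,
    lintegral_map hTS (measurable_ofIndexed_active K),
    Measure.map_apply (measurable_evolved K t) hS, jointLaw,
    Measure.prod_apply (measurable_evolved K t hS)]
  refine lintegral_congr_ae ?_
  filter_upwards [ae_clusterLaw_of_ae ae_injective_infinitePi,
    ae_clusterLaw_of_ae (ae_far_infinitePi hfar)] with o h1 h2
  have hmeas : Measurable fun w : ℕ × ℕ → Noise d => evolved K t (o, w) :=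
    (measurable_evolved K t).comp measurable_prodMk_left
  rw [transition_ofIndexed h1.injOn (isLocallyFinite_image_active K o.1 h2)]
  exact Measure.map_apply hmeas hS

/-- The event that an active particle of one of the clusters in `F` is in the ball. -/
def visits (F : Finset ℕ) (R : ℝ) (t : ℝ≥0) :
    Set (((ℕ → ℕ) × (ℕ × ℕ → Space d)) × (ℕ × ℕ → Noise d)) :=
  {p | ∃ k ∈ F, ∃ j < p.1.1 k, particle (p.2 (k, j)) (p.1.2 (k, j)) t ∈ Metric.closedBall 0 R}

lemma measurableSet_visits (F : Finset ℕ) (R : ℝ) (t : ℝ≥0) :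
    MeasurableSet (visits (d := d) F R t) := by
  have : visits (d := d) F R t = ⋃ k ∈ F, ⋃ j, {p | j < p.1.1 k} ∩
      {p | particle (p.2 (k, j)) (p.1.2 (k, j)) t ∈ Metric.closedBall 0 R} := by
    ext p
    simp [visits]
  rw [this]
  refine .biUnion F.countable_toSet fun k _ => .iUnion fun j => ?_
  have h1 : Measurable fun p : ((ℕ → ℕ) × (ℕ × ℕ → Space d)) × (ℕ × ℕ → Noise d) => p.1.1 k := by
    fun_prop
  have h2 : Measurable fun p : ((ℕ → ℕ) × (ℕ × ℕ → Space d)) × (ℕ × ℕ → Noise d) =>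
      particle (p.2 (k, j)) (p.1.2 (k, j)) t :=
    ((measurable_pi_apply (k, j)).comp (measurable_snd.comp measurable_fst)).sub
      ((measurable_displacement t).comp ((measurable_pi_apply (k, j)).comp measurable_snd))
  exact (measurableSet_lt measurable_const h1).inter (h2 measurableSet_closedBall)

/-- A union bound given the initial data. With the minimum, the limit in time follows by dominated
convergence from finiteness of the particle number, without any moment. -/
lemma jointLaw_visits_le [IsProbabilityMeasure (noiseLaw a)] (F : Finset ℕ) {R : ℝ} {t : ℝ≥0} {q : ℝ≥0∞}
    (hq : ∀ x, noiseLaw a {w | particle w x t ∈ Metric.closedBall 0 R} ≤ q) :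
    jointLaw a m ν (visits F R t) ≤
      ∫⁻ o, min ((∑ k ∈ F, (o.1 k : ℝ≥0∞)) * q) 1 ∂(clusterLaw m ν) := by
  rw [jointLaw, Measure.prod_apply (measurableSet_visits F R t)]
  refine lintegral_mono fun o => le_min ?_ prob_le_one
  set P := Measure.infinitePi fun _ : ℕ × ℕ => noiseLaw a
  have hs : ∀ x : Space d, MeasurableSet {w | particle w x t ∈ Metric.closedBall 0 R} := fun x =>
    (measurable_const.sub (measurable_displacement t)) measurableSet_closedBall
  have hsub : Prod.mk o ⁻¹' visits F R t ⊆ ⋃ k ∈ F, ⋃ j ∈ Finset.range (o.1 k),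
      (fun w : ℕ × ℕ → Noise d => w (k, j)) ⁻¹'
        {w | particle w (o.2 (k, j)) t ∈ Metric.closedBall 0 R} := by
    rintro w ⟨k, hk, j, hj, h⟩
    simp only [Set.mem_iUnion]
    exact ⟨k, hk, j, Finset.mem_range.2 hj, h⟩
  calc P (Prod.mk o ⁻¹' visits F R t)
      ≤ ∑ k ∈ F, ∑ j ∈ Finset.range (o.1 k), P ((fun w : ℕ × ℕ → Noise d => w (k, j)) ⁻¹'
        {w | particle w (o.2 (k, j)) t ∈ Metric.closedBall 0 R}) :=
        (measure_mono hsub).trans ((measure_biUnion_finset_le _ _).trans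
          (Finset.sum_le_sum fun k _ => measure_biUnion_finset_le _ _))
    _ ≤ ∑ k ∈ F, ∑ j ∈ Finset.range (o.1 k), q := by
        refine Finset.sum_le_sum fun k _ => Finset.sum_le_sum fun j _ => ?_
        rw [← Measure.map_apply (measurable_pi_apply (k, j)) (hs _),
          Measure.infinitePi_map_eval (fun _ : ℕ × ℕ => noiseLaw a) (k, j)]
        exact hq _
    _ = (∑ k ∈ F, (o.1 k : ℝ≥0∞)) * q := by simp [Finset.sum_mul]

lemma tendsto_jointLaw_visits [IsProbabilityMeasure (noiseLaw a)]
    [∀ k, IsProbabilityMeasure (ν k)] (F : Finset ℕ) {R : ℝ} {q : ℝ≥0 → ℝ≥0∞}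
    (hq0 : Tendsto q atTop (𝓝 0))
    (hq : ∀ t x, noiseLaw a {w | particle w x t ∈ Metric.closedBall 0 R} ≤ q t) :
    Tendsto (fun t => jointLaw a m ν (visits F R t)) atTop (𝓝 0) := by
  suffices h : Tendsto (fun t => ∫⁻ o, min ((∑ k ∈ F, (o.1 k : ℝ≥0∞)) * q t) 1 ∂(clusterLaw m ν))
      atTop (𝓝 (∫⁻ _, 0 ∂(clusterLaw m ν))) by
    rw [lintegral_zero] at h
    exact tendsto_of_tendsto_of_tendsto_of_le_of_le tendsto_const_nhds h (fun _ => zero_le)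
      fun t => jointLaw_visits_le F (hq t)
  refine tendsto_lintegral_filter_of_dominated_convergence (fun _ => 1)
    (Eventually.of_forall fun t => ?_)
    (Eventually.of_forall fun t => ae_of_all _ fun o => min_le_right _ _) (by simp) ?_
  · refine Measurable.min ?_ measurable_const
    refine Measurable.mul_const (Finset.measurable_sum _ fun k _ => ?_) _
    exact Measurable.of_discrete.comp ((measurable_pi_apply k).comp measurable_fst)
  · refine ae_of_all _ fun o => ?_
    have h1 : Tendsto (fun t => (∑ k ∈ F, (o.1 k : ℝ≥0∞)) * q t) atTop
        (𝓝 ((∑ k ∈ F, (o.1 k : ℝ≥0∞)) * 0)) :=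
      ENNReal.Tendsto.const_mul hq0 (Or.inr (by simp))
    rw [mul_zero] at h1
    have h2 := h1.min (tendsto_const_nhds (x := (1 : ℝ≥0∞)))
    rwa [min_eq_left zero_le_one] at h2

/-- Both systems use the same points and noises. Unless a particle from `F` is in the ball, they
have the same points there, and a local event cannot tell them apart. -/
lemma map_evolved_le {K K' : Set ℕ} {F : Finset ℕ} (h : K ⊆ K' ∪ F) (h' : K' ⊆ K ∪ F)
    {R : ℝ} (t : ℝ≥0) {S : Set (Config d)} (hS : MeasurableSet S) (hl : Config.IsLocal R S) :
    (jointLaw a m ν).map (evolved K t) S ≤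
      (jointLaw a m ν).map (evolved K' t) S + jointLaw a m ν (visits F R t) := by
  rw [Measure.map_apply (measurable_evolved K t) hS, Measure.map_apply (measurable_evolved K' t) hS]
  refine (measure_mono fun p hp => ?_).trans (measure_union_le _ _)
  by_cases hv : p ∈ visits F R t
  · exact Or.inr hv
  left
  have hgo : ∀ {L L' : Set ℕ}, L ⊆ L' ∪ F → ∀ i ∈ active L p.1.1, i ∈ active L' p.1.1 ∨
      i.1 ∈ F ∧ i.2 < p.1.1 i.1 := fun hL i hi =>
    (hL hi.1).imp (fun h => ⟨h, hi.2⟩) fun h => ⟨Finset.mem_coe.1 h, hi.2⟩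
  let x : ℕ × ℕ → Space d := fun i => particle (p.2 i) (p.1.2 i) t
  let D : Finset (ℕ × ℕ) := (F.sigma fun k => Finset.range (p.1.1 k)).map
      (Equiv.sigmaEquivProd ℕ ℕ).toEmbedding
  have hD : ∀ i : ℕ × ℕ, i ∈ D ↔ i.1 ∈ F ∧ i.2 < p.1.1 i.1 := by
    rintro ⟨k, j⟩
    simp [D, Finset.mem_map_equiv]
  have hsub : ∀ {L L' : Set ℕ}, L ⊆ L' ∪ F →
      x '' active L p.1.1 ⊆ x '' active L' p.1.1 ∪ x '' D := by
    rintro L L' hL _ ⟨i, hi, rfl⟩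
    exact (hgo hL i hi).imp (fun h => ⟨i, h, rfl⟩) fun h => ⟨i, (hD i).2 h, rfl⟩
  have hball : ∀ {L L' : Set ℕ}, L ⊆ L' ∪ F →
      x '' active L p.1.1 ∩ Metric.closedBall 0 R ⊆
        x '' active L' p.1.1 ∩ Metric.closedBall 0 R := by
    rintro L L' hL _ ⟨⟨i, hi, rfl⟩, hb⟩
    rcases hgo hL i hi with h | h
    · exact ⟨⟨i, h, rfl⟩, hb⟩
    · exact absurd ⟨i.1, h.1, i.2, h.2, hb⟩ hv
  refine hl _ _ ?_ hp
  exact ofSet_inter_closedBall_eq ((hball h).antisymm (hball h')) (D.finite_toSet.image x)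
    (hsub h) (hsub h')

end evolution

/-! ### Decomposition of intensities -/

lemma exists_eq_smul_probability {μ : Measure (Space d)} [IsFiniteMeasure μ] (hμ : μ ≪ volume)
    {s : Set (Space d)} (hs : MeasurableSet s) (hs0 : volume s ≠ 0) (hμs : μ sᶜ = 0) :
    ∃ (m : ℝ≥0) (ν : Measure (Space d)), IsProbabilityMeasure ν ∧ ν ≪ volume ∧ ν sᶜ = 0 ∧
      μ = m • ν := by
  by_cases h0 : μ = 0
  · obtain ⟨u, hus, hu, hu0, hutop⟩ :=
      Measure.exists_subset_measure_lt_top hs (pos_iff_ne_zero.2 hs0)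
    refine ⟨0, cond volume u, cond_isProbabilityMeasure_of_finite hu0.ne' hutop.ne,
      cond_absolutelyContinuous, ?_, by simp [h0]⟩
    rw [cond_apply hus, (Set.disjoint_compl_right_iff_subset.2 hu).inter_eq, measure_empty,
      mul_zero]
  · have hu0 : μ Set.univ ≠ 0 := by simpa using h0
    refine ⟨(μ Set.univ).toNNReal, (μ Set.univ)⁻¹ • μ,
      ⟨by simp [ENNReal.inv_mul_cancel hu0 (measure_ne_top _ _)]⟩,
      Measure.AbsolutelyContinuous.smul_left hμ _, by simp [hμs], ?_⟩
    ext v _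
    simp only [Measure.smul_apply, smul_eq_mul]
    rw [ENNReal.smul_def, ENNReal.coe_toNNReal (measure_ne_top _ _), smul_eq_mul, ← mul_assoc,
      ENNReal.mul_inv_cancel hu0 (measure_ne_top _ _), one_mul]

/-- The points whose distance from the origin has integer part `k`. -/
def shell (d k : ℕ) : Set (Space d) := {x | ⌊‖x‖⌋₊ = k}

lemma measurableSet_shell (k : ℕ) : MeasurableSet (shell d k) :=
  (Nat.measurable_floor.comp measurable_norm) (measurableSet_singleton k)

lemma shell_subset_closedBall (k : ℕ) : shell d k ⊆ Metric.closedBall 0 (k + 1) := by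
  rintro x rfl
  rw [mem_closedBall_zero_iff]
  exact (Nat.lt_floor_add_one _).le

lemma volume_shell_ne_zero [Nontrivial (Space d)] (k : ℕ) : volume (shell d k) ≠ 0 := by
  have ho : IsOpen {x : Space d | (k : ℝ) < ‖x‖ ∧ ‖x‖ < k + 1} :=
    (isOpen_lt continuous_const continuous_norm).inter (isOpen_lt continuous_norm continuous_const)
  have hne : {x : Space d | (k : ℝ) < ‖x‖ ∧ ‖x‖ < k + 1}.Nonempty := by
    obtain ⟨x, hx⟩ := exists_norm_eq (Space d) (c := k + 1 / 2) (by positivity)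
    exact ⟨x, by rw [hx]; linarith, by rw [hx]; linarith⟩
  refine ((ho.measure_pos volume hne).trans_le (measure_mono fun x hx => ?_)).ne'
  exact (Nat.floor_eq_iff (norm_nonneg _)).2 ⟨hx.1.le, hx.2⟩

/-- The common part of `z₁` and `z₂`, cut into shells, preceded by the excesses of `z₁` and `z₂`. -/
noncomputable def pieces (z₁ z₂ : Space d → ℝ) : ℕ → Measure (Space d)
  | 0 => volume.withDensity fun x => ENNReal.ofReal (z₁ x - z₂ x)
  | 1 => volume.withDensity fun x => ENNReal.ofReal (z₂ x - z₁ x)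
  | k + 2 => (volume.withDensity fun x => ENNReal.ofReal (min (z₁ x) (z₂ x))).restrict (shell d k)

lemma sum_restrict_shell (μ : Measure (Space d)) :
    Measure.sum (fun k => μ.restrict (shell d k)) = μ := by
  rw [← Measure.restrict_iUnion (fun i j hij => Set.disjoint_left.2 fun x hi hj =>
    hij (hi.symm.trans hj)) measurableSet_shell]
  have : ⋃ k, shell d k = Set.univ := Set.eq_univ_of_forall fun x => Set.mem_iUnion.2 ⟨_, rfl⟩
  rw [this, Measure.restrict_univ]

/-- `ENNReal.ofReal` truncates to the positive part, so this is `(z₁ - z₂)⁺ + min z₁ z₂ = z₁`. -/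
lemma withDensity_sub_add_min {z₁ z₂ : Space d → ℝ} (hz₁ : Measurable z₁) (hz₂ : Measurable z₂)
    (h₂ : ∀ x, 0 ≤ z₂ x) :
    (volume.withDensity fun x => ENNReal.ofReal (z₁ x - z₂ x)) +
      (volume.withDensity fun x => ENNReal.ofReal (min (z₁ x) (z₂ x))) =
      volume.withDensity fun x => ENNReal.ofReal (z₁ x) := by
  rw [← withDensity_add_left (by fun_prop)]
  congr 1
  funext x
  rw [Pi.add_apply]
  rcases le_total (z₁ x) (z₂ x) with h | h
  · rw [min_eq_left h, ENNReal.ofReal_of_nonpos (sub_nonpos.2 h), zero_add]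
  · rw [min_eq_right h, ← ENNReal.ofReal_add (sub_nonneg.2 h) (h₂ x), sub_add_cancel]

lemma sum_measure_eq (μ : ℕ → Measure (Space d)) :
    Measure.sum μ = μ 0 + (μ 1 + Measure.sum fun k => μ (k + 2)) := by
  ext s hs
  rw [Measure.add_apply, Measure.add_apply, Measure.sum_apply _ hs, Measure.sum_apply _ hs,
    tsum_eq_zero_add' ENNReal.summable, tsum_eq_zero_add' ENNReal.summable]

lemma sum_pieces_left {z₁ z₂ : Space d → ℝ} (hz₁ : Measurable z₁) (hz₂ : Measurable z₂)
    (h₂ : ∀ x, 0 ≤ z₂ x) :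
    Measure.sum (fun k => if k ∈ {k : ℕ | k ≠ 1} then pieces z₁ z₂ k else 0) =
      volume.withDensity fun x => ENNReal.ofReal (z₁ x) := by
  rw [sum_measure_eq]
  simp only [Set.mem_ofPred_eq, pieces]
  simp [sum_restrict_shell, withDensity_sub_add_min hz₁ hz₂ h₂, -ENNReal.ofReal_min]

lemma sum_pieces_right {z₁ z₂ : Space d → ℝ} (hz₁ : Measurable z₁) (hz₂ : Measurable z₂)
    (h₁ : ∀ x, 0 ≤ z₁ x) :
    Measure.sum (fun k => if k ∈ {k : ℕ | k ≠ 0} then pieces z₁ z₂ k else 0) =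
      volume.withDensity fun x => ENNReal.ofReal (z₂ x) := by
  rw [sum_measure_eq]
  simp only [Set.mem_ofPred_eq, pieces]
  simp [sum_restrict_shell, min_comm (z₁ _), withDensity_sub_add_min hz₂ hz₁ h₁,
    -ENNReal.ofReal_min]

/-- Integrability of the difference makes the two excess clusters finite; the common pieces are
finite because shells are bounded. -/
lemma isFiniteMeasure_pieces {z₁ z₂ : Space d → ℝ} (hb : ∃ M : ℝ, ∀ x, z₁ x ≤ M)
    (hz : Integrable fun x => z₁ x - z₂ x) (k : ℕ) : IsFiniteMeasure (pieces z₁ z₂ k) := by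
  match k with
  | 0 => exact isFiniteMeasure_withDensity_ofReal hz.2
  | 1 =>
    have : Integrable fun x => z₂ x - z₁ x := by
      simpa [Pi.neg_def] using hz.neg
    exact isFiniteMeasure_withDensity_ofReal this.2
  | k + 2 =>
    obtain ⟨M, hM⟩ := hb
    constructor
    rw [pieces, Measure.restrict_apply_univ, withDensity_apply _ (measurableSet_shell k)]
    calc ∫⁻ x in shell d k, ENNReal.ofReal (min (z₁ x) (z₂ x))
        ≤ ∫⁻ _ in shell d k, ENNReal.ofReal M :=
          lintegral_mono fun x => ENNReal.ofReal_le_ofReal ((min_le_left _ _).trans (hM x))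
      _ = ENNReal.ofReal M * volume (shell d k) := by simp
      _ < ⊤ := ENNReal.mul_lt_top ENNReal.ofReal_lt_top
          ((measure_mono (shell_subset_closedBall k)).trans_lt measure_closedBall_lt_top)

lemma pieces_absolutelyContinuous (z₁ z₂ : Space d → ℝ) (k : ℕ) : pieces z₁ z₂ k ≪ volume := by
  match k with
  | 0 => exact withDensity_absolutelyContinuous _ _
  | 1 => exact withDensity_absolutelyContinuous _ _
  | k + 2 =>
    exact (Measure.absolutelyContinuous_of_le Measure.restrict_le_self).trans
      (withDensity_absolutelyContinuous _ _)

lemma exists_normalized_pieces [Nontrivial (Space d)] {z₁ z₂ : Space d → ℝ}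
    (hb : ∃ M : ℝ, ∀ x, z₁ x ≤ M) (hz : Integrable fun x => z₁ x - z₂ x) :
    ∃ (m : ℕ → ℝ≥0) (ν : ℕ → Measure (Space d)), (∀ k, IsProbabilityMeasure (ν k)) ∧
      (∀ k, ν k ≪ volume) ∧ (∀ R : ℝ, ∀ᶠ k in atTop, ν k (Metric.closedBall 0 R) = 0) ∧
      ∀ k, pieces z₁ z₂ k = m k • ν k := by
  have hs : ∀ k, ∃ s : Set (Space d), MeasurableSet s ∧ volume s ≠ 0 ∧ pieces z₁ z₂ k sᶜ = 0 ∧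
      ∀ j, k = j + 2 → s = shell d j := by
    intro k
    match k with
    | 0 => exact ⟨Set.univ, .univ, by simp, by simp, fun j hj => by omega⟩
    | 1 => exact ⟨Set.univ, .univ, by simp, by simp, fun j hj => by omega⟩
    | k + 2 =>
      refine ⟨shell d k, measurableSet_shell k, volume_shell_ne_zero k, ?_, fun j hj => ?_⟩
      · rw [pieces, Measure.restrict_apply (measurableSet_shell k).compl, Set.compl_inter_self,
          measure_empty]
      · rw [Nat.add_right_cancel hj]
  choose s hsm hs0 hsc hsj using hs
  have h : ∀ k, ∃ (m : ℝ≥0) (ν : Measure (Space d)), IsProbabilityMeasure ν ∧ ν ≪ volume ∧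
      ν (s k)ᶜ = 0 ∧ pieces z₁ z₂ k = m • ν := fun k =>
    have := isFiniteMeasure_pieces hb hz k
    exists_eq_smul_probability (pieces_absolutelyContinuous z₁ z₂ k) (hsm k) (hs0 k) (hsc k)
  choose m ν hν hac hνs heq using h
  refine ⟨m, ν, hν, hac, fun R => ?_, heq⟩
  -- Index `j + 2` carries the shell of norms in `[j, j + 1)`, hence the threshold `n + 2`.
  obtain ⟨n, hn⟩ := exists_nat_gt R
  filter_upwards [eventually_ge_atTop (n + 2)] with k hk
  obtain ⟨j, rfl⟩ : ∃ j, k = j + 2 := ⟨k - 2, by omega⟩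
  refine measure_mono_null (t := (s (j + 2))ᶜ) (fun x hx hxs => ?_) (hνs (j + 2))
  rw [hsj _ j rfl] at hxs
  rw [mem_closedBall_zero_iff] at hx
  have h1 : (j : ℝ) ≤ ‖x‖ := by
    rw [← show ⌊‖x‖⌋₊ = j from hxs]
    exact Nat.floor_le (norm_nonneg _)
  have h2 : (n : ℝ) ≤ j := by exact_mod_cast (by omega : n ≤ j)
  linarith

/-! ### Transfer of limits through the coupling. -/

lemma ConvergesWeakly.evolved {a : Space d → ℝ} (ha0 : ∀ y, 0 ≤ a y) (ha : 0 < totalRate a)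
    (i₀ : Fin d) {m : ℕ → ℝ≥0} {ν : ℕ → Measure (Space d)} [∀ k, IsProbabilityMeasure (ν k)]
    {K K' : Set ℕ} (F : Finset ℕ) (h : K ⊆ K' ∪ F) (h' : K' ⊆ K ∪ F) {ι : Type} {l : Filter ι}
    [l.IsCountablyGenerated] {u : ι → ℝ≥0} (hu : Tendsto u l atTop) {ρ : Measure (Config d)}
    [IsProbabilityMeasure ρ]
    (hK : ConvergesWeakly (fun i => (jointLaw a m ν).map (evolved K (u i))) l ρ) :
    ConvergesWeakly (fun i => (jointLaw a m ν).map (FreeKawasaki.evolved K' (u i))) l ρ := by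
  have := isProbabilityMeasure_noiseLaw ha0 ha
  have hp : ∀ (L : Set ℕ) (t : ℝ≥0),
      IsProbabilityMeasure ((jointLaw a m ν).map (FreeKawasaki.evolved L t)) := fun L t =>
    Measure.isProbabilityMeasure_map (measurable_evolved L t).aemeasurable
  -- The error for radius `R` is the probability that a particle from `F` is in the ball, which
  -- vanishes by escape.
  refine ConvergesWeakly.of_local (fun R => ?_) hK
  obtain ⟨q, hq0, hq⟩ := exists_bound_particle_mem_closedBall ha0 ha i₀ R
  exact ⟨fun i => jointLaw a m ν (visits F R (u i)), (tendsto_jointLaw_visits F hq0 hq).comp hu,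
    fun S hS hl i => map_evolved_le h h' (u i) hS hl⟩

lemma exists_isPoisson_oneDimDistribution_eq [Nontrivial (Space d)] {a z₁ z₂ : Space d → ℝ}
    [IsProbabilityMeasure (noiseLaw a)]
    (hz₁_meas : Measurable z₁) (hz₂_meas : Measurable z₂)
    (hz₁_nonneg : ∀ x, 0 ≤ z₁ x) (hz₂_nonneg : ∀ x, 0 ≤ z₂ x)
    (hz₁_bdd : ∃ M : ℝ, ∀ x, z₁ x ≤ M) (hz₂_bdd : ∃ M : ℝ, ∀ x, z₂ x ≤ M)
    (hz : Integrable (fun x => z₁ x - z₂ x)) :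
    ∃ (m : ℕ → ℝ≥0) (ν : ℕ → Measure (Space d)), (∀ k, IsProbabilityMeasure (ν k)) ∧
      (IsProbabilityMeasure (poissonField z₁) ∧ ∀ t, oneDimDistribution a (poissonField z₁) t =
        (jointLaw a m ν).map (evolved {k | k ≠ 1} t)) ∧
      (IsProbabilityMeasure (poissonField z₂) ∧ ∀ t, oneDimDistribution a (poissonField z₂) t =
        (jointLaw a m ν).map (evolved {k | k ≠ 0} t)) := by
  obtain ⟨m, ν, hν, hac, hfar, heq⟩ := exists_normalized_pieces hz₁_bdd hz
  have : ∀ k, NullSingletonClass (ν k) := fun k => ⟨fun x => hac k (measure_singleton x)⟩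
  have hsum₁ := sum_pieces_left hz₁_meas hz₂_meas hz₂_nonneg
  have hsum₂ := sum_pieces_right hz₁_meas hz₂_meas hz₁_nonneg
  have hpieces : pieces z₁ z₂ = fun k => m k • ν k := funext heq
  rw [hpieces] at hsum₁ hsum₂
  have hπ₁ := isPoisson_map_clusterLaw hfar hz₁_meas hz₁_nonneg hz₁_bdd {k | k ≠ 1} hsum₁
  have hπ₂ := isPoisson_map_clusterLaw hfar hz₂_meas hz₂_nonneg hz₂_bdd {k | k ≠ 0} hsum₂
  refine ⟨m, ν, hν, ?_, ?_⟩
  · rw [poissonField_eq hπ₁]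
    exact ⟨hπ₁.1, fun t => oneDimDistribution_map_clusterLaw hfar _ t⟩
  · rw [poissonField_eq hπ₂]
    exact ⟨hπ₂.1, fun t => oneDimDistribution_map_clusterLaw hfar _ t⟩

end FreeKawasaki

theorem mainTheorem10 {d : ℕ} (hd : 1 ≤ d)
    (a : FreeKawasaki.Space d → ℝ) (ha_meas : Measurable a) (ha_nonneg : ∀ y, 0 ≤ a y)
    (ha_decay : ∃ α C : ℝ, 2 * (d : ℝ) < α ∧ ∀ y, a y ≤ C / (1 + ‖y‖) ^ α)
    (ha_pos : 0 < ∫ y, a y)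
    (z₁ z₂ : FreeKawasaki.Space d → ℝ)
    (hz₁_meas : Measurable z₁) (hz₂_meas : Measurable z₂)
    (hz₁_nonneg : ∀ x, 0 ≤ z₁ x) (hz₂_nonneg : ∀ x, 0 ≤ z₂ x)
    (hz₁_bdd : ∃ M : ℝ, ∀ x, z₁ x ≤ M) (hz₂_bdd : ∃ M : ℝ, ∀ x, z₂ x ≤ M)
    (hz : Integrable (fun x => z₁ x - z₂ x)) :
    -- both one-dimensional distributions are well defined
    (∀ t : ℝ≥0,
      IsProbabilityMeasure
        (FreeKawasaki.oneDimDistribution a (FreeKawasaki.poissonField z₁) t) ∧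
      IsProbabilityMeasure
        (FreeKawasaki.oneDimDistribution a (FreeKawasaki.poissonField z₂) t)) ∧
    -- they have the same weak limit as `t → ∞`
    (∀ ν : Measure (FreeKawasaki.Config d), IsProbabilityMeasure ν →
      (FreeKawasaki.ConvergesWeakly
          (fun t : ℝ≥0 => FreeKawasaki.oneDimDistribution a (FreeKawasaki.poissonField z₁) t)
          atTop ν ↔
        FreeKawasaki.ConvergesWeakly
          (fun t : ℝ≥0 => FreeKawasaki.oneDimDistribution a (FreeKawasaki.poissonField z₂) t)
          atTop ν)) ∧
    -- and the same weak limits along all sequences of times tending to infinity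
    (∀ u : ℕ → ℝ≥0, Tendsto u atTop atTop →
      ∀ ν : Measure (FreeKawasaki.Config d), IsProbabilityMeasure ν →
        (FreeKawasaki.ConvergesWeakly
            (fun n : ℕ => FreeKawasaki.oneDimDistribution a (FreeKawasaki.poissonField z₁) (u n))
            atTop ν ↔
          FreeKawasaki.ConvergesWeakly
            (fun n : ℕ => FreeKawasaki.oneDimDistribution a (FreeKawasaki.poissonField z₂) (u n))
            atTop ν)) := by
  have i₀ : Fin d := ⟨0, hd⟩
  have : Nonempty (Fin d) := ⟨i₀⟩
  have hnoise := FreeKawasaki.isProbabilityMeasure_noiseLaw ha_nonneg ha_pos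
  obtain ⟨m, ν, hν, ⟨hp₁, h₁⟩, ⟨hp₂, h₂⟩⟩ :=
    FreeKawasaki.exists_isPoisson_oneDimDistribution_eq (a := a) hz₁_meas hz₂_meas hz₁_nonneg
      hz₂_nonneg hz₁_bdd hz₂_bdd hz
  refine ⟨fun t => ⟨FreeKawasaki.isProbabilityMeasure_oneDimDistribution t,
    FreeKawasaki.isProbabilityMeasure_oneDimDistribution t⟩, ?_⟩
  simp only [h₁, h₂]
  -- The two systems differ only in clusters 0 and 1, the two excesses.
  have h₁₂ : {k : ℕ | k ≠ 1} ⊆ {k | k ≠ 0} ∪ (({0, 1} : Finset ℕ) : Set ℕ) := by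
    intro k hk
    by_cases h : k = 0 <;> simp [h]
  have h₂₁ : {k : ℕ | k ≠ 0} ⊆ {k | k ≠ 1} ∪ (({0, 1} : Finset ℕ) : Set ℕ) := by
    intro k hk
    by_cases h : k = 1 <;> simp [h]
  exact ⟨fun ρ _ => ⟨fun h => h.evolved (u := fun t => t) ha_nonneg ha_pos i₀ _ h₁₂ h₂₁ tendsto_id,
    fun h => h.evolved (u := fun t => t) ha_nonneg ha_pos i₀ _ h₂₁ h₁₂ tendsto_id⟩,
    fun u hu ρ _ => ⟨fun h => h.evolved (u := u) ha_nonneg ha_pos i₀ _ h₁₂ h₂₁ hu,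
    fun h => h.evolved (u := u) ha_nonneg ha_pos i₀ _ h₂₁ h₁₂ hu⟩⟩
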